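/- Let $A,B,C$ be finite-dimensional quantum systems. All logarithms are to base $2$, $S$ denotes the von Neumann entropy, and for a state $\rho^{ABC}$ put $$I(A:C|B)_\rho=S(AB)_\rho+S(BC)_\rho-S(ABC)_\rho-S(B)_\rho,\qquad I(A:BC)_\rho=S(A)_\rho+S(BC)_\rho-S(ABC)_\rho .$$ A tripartite state $\Upsilon^{ABC}$ is called a Markov state conditioned by $B$ if $I(A:C|B)_\Upsilon=0$. For $R\in\mathbb R$, a state $\rho^{ABC}$ is *Markovianized with the randomness cost $R$ on $A$, conditioned by $B$*, if for every $\epsilon>0$ there is $n_\epsilon$ such that for every $n\ge n_\epsilon$, with $N=\lfloor 2^{nR}\rfloor$, we have $N\ge 1$ and there are unitaries $V_1,\dots,V_N$ on $A^n$ and a Markov state $\Upsilon^{A^nB^nC^n}$ conditioned by $B^n$ with $$\Big\|\frac1N\sum_{k=1}^N (V_k\otimes I^{B^nC^n})\,\rho^{\otimes n}\,(V_k\otimes I^{B^nC^n})^\dagger-\Upsilon^{A^nB^nC^n}\Big\|_1\le\epsilon .$$ The Markovianizing cost $M_{A|B}(\rho^{ABC})$ is the infimum (in the extended reals) of all $R$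 such that $\rho^{ABC}$ is Markovianized with the randomness cost $R$ on $A$, conditioned by $B$. Then for every (possibly mixed) state $\rho^{ABC}$, $$I(A:C|B)_\rho\;\le\; M_{A|B}(\rho^{ABC})\;\le\; I(A:BC)_\rho .$$ Consequently, if $M_{A|B}(\rho^{ABC})=0$, then $\rho^{ABC}$ is a Markov state conditioned by $B$. -/

import Mathlib

open scoped Kronecker ComplexOrder

/-- A quantum state on the finite-dimensional Hilbert space `ℂ^ι`: a density matrix. -/
structure QState (ι : Type*) [Fintype ι] [DecidableEq ι] where
  mat : Matrix ι ι ℂ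
  posSemidef : mat.PosSemidef
  trace_eq_one : mat.trace = 1

/-- Partial trace over the first tensor factor. -/
def ptraceLeft {α β : Type*} [Fintype α] (M : Matrix (α × β) (α × β) ℂ) : Matrix β β ℂ :=
  Matrix.of fun i j => ∑ a, M (a, i) (a, j)

/-- Partial trace over the second tensor factor. -/
def ptraceRight {α β : Type*} [Fintype β] (M : Matrix (α × β) (α × β) ℂ) : Matrix α α ℂ :=
  Matrix.of fun i j => ∑ b, M (i, b) (j, b)

theorem ptraceLeft_posSemidef {α β : Type*} [Fintype α] [Fintype β]
    {M : Matrix (α × β) (α × β) ℂ} (hM : M.PosSemidef) : (ptraceLeft M).PosSemidef := by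
  have h : ptraceLeft M = ∑ a, M.submatrix (fun i => (a, i)) (fun i => (a, i)) := by
    ext i j
    simp [ptraceLeft, Matrix.sum_apply]
  rw [h]
  exact Matrix.posSemidef_sum _ fun a _ => hM.submatrix _

theorem ptraceRight_posSemidef {α β : Type*} [Fintype α] [Fintype β]
    {M : Matrix (α × β) (α × β) ℂ} (hM : M.PosSemidef) : (ptraceRight M).PosSemidef := by
  have h : ptraceRight M = ∑ b, M.submatrix (fun i => (i, b)) (fun i => (i, b)) := by
    ext i j
    simp [ptraceRight, Matrix.sum_apply]
  rw [h]
  exact Matrix.posSemidef_sum _ fun b _ => hM.submatrix _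

namespace QState

/-- The reduced state on the second factor. -/
def snd {α β : Type*} [Fintype α] [DecidableEq α] [Fintype β] [DecidableEq β]
    (ρ : QState (α × β)) : QState β where
  mat := ptraceLeft ρ.mat
  posSemidef := ptraceLeft_posSemidef ρ.posSemidef
  trace_eq_one := by
    rw [← ρ.trace_eq_one]
    simp only [Matrix.trace, Matrix.diag, ptraceLeft, Matrix.of_apply, Fintype.sum_prod_type]
    exact Finset.sum_comm

/-- The reduced state on the first factor. -/
def fst {α β : Type*} [Fintype α] [DecidableEq α] [Fintype β] [DecidableEq β]
    (ρ : QState (α × β)) : QState α where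
  mat := ptraceRight ρ.mat
  posSemidef := ptraceRight_posSemidef ρ.posSemidef
  trace_eq_one := by
    rw [← ρ.trace_eq_one]
    simp only [Matrix.trace, Matrix.diag, ptraceRight, Matrix.of_apply, Fintype.sum_prod_type]

/-- The identification of `A ⊗ (B ⊗ C)` with `(A ⊗ B) ⊗ C`. -/
def assoc {α β γ : Type*} [Fintype α] [DecidableEq α] [Fintype β] [DecidableEq β]
    [Fintype γ] [DecidableEq γ] (ρ : QState (α × β × γ)) : QState ((α × β) × γ) where
  mat := ρ.mat.submatrix (Equiv.prodAssoc α β γ) (Equiv.prodAssoc α β γ)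
  posSemidef := ρ.posSemidef.submatrix _
  trace_eq_one := by
    rw [← ρ.trace_eq_one]
    exact Fintype.sum_equiv (Equiv.prodAssoc α β γ) _ _ fun _ => rfl

/-- The von Neumann entropy `-Tr (ρ log₂ ρ)`, in bits. -/
noncomputable def entropy {ι : Type*} [Fintype ι] [DecidableEq ι] (ρ : QState ι) : ℝ :=
  ∑ i, -(ρ.posSemidef.isHermitian.eigenvalues i *
    Real.logb 2 (ρ.posSemidef.isHermitian.eigenvalues i))

/-- Quantum mutual information `I(X:Y) = S(X) + S(Y) - S(XY)`. -/
noncomputable def mutualInfo {α β : Type*} [Fintype α] [DecidableEq α]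
    [Fintype β] [DecidableEq β] (ρ : QState (α × β)) : ℝ :=
  ρ.fst.entropy + ρ.snd.entropy - ρ.entropy

/-- Quantum conditional mutual information of a state on `ABC`:
`I(A:C|B) = S(AB) + S(BC) - S(ABC) - S(B)`. -/
noncomputable def condMutualInfo {α β γ : Type*} [Fintype α] [DecidableEq α]
    [Fintype β] [DecidableEq β] [Fintype γ] [DecidableEq γ] (ρ : QState (α × β × γ)) : ℝ :=
  ρ.assoc.fst.entropy + ρ.snd.entropy - ρ.entropy - ρ.snd.fst.entropy

/-- A state on `ABC` is a Markov state conditioned by `B` if `I(A:C|B) = 0`. -/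
def IsMarkov {α β γ : Type*} [Fintype α] [DecidableEq α]
    [Fintype β] [DecidableEq β] [Fintype γ] [DecidableEq γ] (ρ : QState (α × β × γ)) : Prop :=
  ρ.condMutualInfo = 0

/-- The density matrix of `ρ^{⊗ n}`, as a tripartite matrix on `Aⁿ`, `Bⁿ`, `Cⁿ`. -/
def tensorPower {α β γ : Type*} [Fintype α] [DecidableEq α]
    [Fintype β] [DecidableEq β] [Fintype γ] [DecidableEq γ] (ρ : QState (α × β × γ)) (n : ℕ) :
    Matrix ((Fin n → α) × (Fin n → β) × (Fin n → γ))
      ((Fin n → α) × (Fin n → β) × (Fin n → γ)) ℂ :=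
  Matrix.of fun x y =>
    ∏ i, ρ.mat (x.1 i, x.2.1 i, x.2.2 i) (y.1 i, y.2.1 i, y.2.2 i)

end QState

/-- The trace norm `‖M‖₁ = Tr √(Mᴴ M)`, the sum of the singular values of `M`. -/
noncomputable def traceNorm {ι : Type*} [Fintype ι] [DecidableEq ι] (M : Matrix ι ι ℂ) : ℝ :=
  ∑ i, √((Matrix.isHermitian_conjTranspose_mul_self M).eigenvalues i)

/-- The random unitary operation `τ ↦ N⁻¹ ∑ₖ (Vₖ ⊗ I) τ (Vₖ ⊗ I)ᴴ` on the first factor. -/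
noncomputable def randomUnitary {α β : Type*} [Fintype α] [DecidableEq α]
    [Fintype β] [DecidableEq β] {N : ℕ} (V : Fin N → Matrix.unitaryGroup α ℂ)
    (τ : Matrix (α × β) (α × β) ℂ) : Matrix (α × β) (α × β) ℂ :=
  (N : ℂ)⁻¹ • ∑ k, ((V k : Matrix α α ℂ) ⊗ₖ (1 : Matrix β β ℂ)) * τ *
    ((V k : Matrix α α ℂ) ⊗ₖ (1 : Matrix β β ℂ)).conjTranspose

/-- `ρ` on `ABC` is Markovianized with the randomness cost `R` on `A`, conditioned by `B`.
The number of unitaries on `Aⁿ` is the integer part of `2^{nR}`, required to be positive. -/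
def IsMarkovianizedWith {α β γ : Type*} [Fintype α] [DecidableEq α]
    [Fintype β] [DecidableEq β] [Fintype γ] [DecidableEq γ]
    (ρ : QState (α × β × γ)) (R : ℝ) : Prop :=
  ∀ ε : ℝ, 0 < ε → ∃ n₀ : ℕ, ∀ n : ℕ, n₀ ≤ n →
    0 < ⌊(2 : ℝ) ^ ((n : ℝ) * R)⌋₊ ∧
    ∃ (V : Fin ⌊(2 : ℝ) ^ ((n : ℝ) * R)⌋₊ → Matrix.unitaryGroup (Fin n → α) ℂ)
      (Υ : QState ((Fin n → α) × (Fin n → β) × (Fin n → γ))),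
      Υ.IsMarkov ∧ traceNorm (randomUnitary V (ρ.tensorPower n) - Υ.mat) ≤ ε

/-- The Markovianizing cost `M_{A|B}(ρ)`: the infimum, in the extended reals, of the
achievable randomness costs. -/
noncomputable def markovCost {α β γ : Type*} [Fintype α] [DecidableEq α]
    [Fintype β] [DecidableEq β] [Fintype γ] [DecidableEq γ] (ρ : QState (α × β × γ)) : EReal :=
  ⨅ (R : ℝ) (_ : IsMarkovianizedWith ρ R), (R : EReal)

/-!
The argument rests on an entropy count for the lower bound and on random unitaries for the upper
bound; the two together also give strong subadditivity, which the last claim needs.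

*Lower bound.* A uniform mixture of `N` unitary conjugates has an entropy between that of the
original state and that entropy plus `log N`. Local unitaries on `A` leave `BC` alone, and they do
not decrease the entropies of `A` and `AB`; so `N` of them remove at most `log N` bits of
`I(A:C|B)` or of `I(A:B)`. If the outcome is within `ε` of a Markov state, then continuity of the
entropy leaves only `O(ε n) + O(1)` bits of `I(A:C|B)`, and comparing with the `n I(A:C|B)` bits
present at the start gives `I(A:C|B) ≤ R` (`QState.condMutualInfo_le_of_isMarkovianizedWith`). The
entropy inequalities for matrices come from Peierls' inequality
(`Matrix.PosSemidef.trNegMulLog_le_diag`) and from the equality of the nonzero spectra of `X Y`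
and `Y X` (`trNegMulLog_mul_comm'`).

*Upper bound.* Every rate `R > I(A:BC)` decouples `A` from `BC`
(`QState.isDecoupledWith_of_mutualInfo_lt`), and a product state of `Aⁿ` and `BⁿCⁿ` is Markov.
Restrict `ρ^{⊗ n}` to the likely subspaces of `Aⁿ` and `BⁿCⁿ`, of dimensions about `2^{nS(A)}` and
`2^{nS(BC)}`, and to its typical eigenvalues, of size about `2^{-nS(ABC)}`. Averaging over all
signed permutations of the likely basis vectors of `Aⁿ` yields a product of the maximally mixed
state with the marginal (`twirl_signedPermOn`). When `N` independent samples replace the full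
average, the squared Hilbert–Schmidt error is at most `2^{-nS(ABC)} / N` for some choice of them
(`exists_unitaryAverage_near_twirl`), so the squared trace norm error is at most the dimension
`2^{n(S(A) + S(BC))}` times this, which tends to zero for `N = 2^{nR}`.

*Vanishing cost.* If the cost is zero then `I(A:C|B) ≤ 0` by the lower bound. Conversely,
`I(A:C|B) = I(A:BC) - I(A:B) ≥ 0` (`QState.condMutualInfo_nonneg`): a rate above `I(A:BC)`
decouples `A` from `BC`, hence from `B`, and the entropy count shows that this takes a rate of at
least `I(A:B)`.
-/

open Matrix Real

/-! ### The entropy functional on matrices -/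

/-- The unnormalised von Neumann entropy `-Tr (M log M)` of a Hermitian matrix, in nats. It is read
off from the roots of the characteristic polynomial, so that no proof of Hermitian symmetry enters
the definition and its invariance under similarity is immediate. -/
noncomputable def trNegMulLog {ι : Type*} [Fintype ι] [DecidableEq ι] (M : Matrix ι ι ℂ) : ℝ :=
  (M.charpoly.roots.map fun z : ℂ => negMulLog z.re).sum

section Spectral

variable {ι κ : Type*} [Fintype ι] [DecidableEq ι] [Fintype κ] [DecidableEq κ]

theorem trNegMulLog_diagonal (d : ι → ℝ) :
    trNegMulLog (diagonal fun i => (d i : ℂ)) = ∑ i, negMulLog (d i) := by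
  rw [trNegMulLog, charpoly_diagonal, Polynomial.roots_prod _ _ (by
    exact Finset.prod_ne_zero_iff.mpr fun i _ => Polynomial.X_sub_C_ne_zero _)]
  simp [Finset.sum_map_val]

theorem trNegMulLog_mul_comm (X Y : Matrix ι ι ℂ) :
    trNegMulLog (X * Y) = trNegMulLog (Y * X) := by
  rw [trNegMulLog, charpoly_mul_comm, ← trNegMulLog]

/-- The nonzero spectra of `X Y` and `Y X` agree also for rectangular factors, and `0` does not
contribute to the entropy. -/
theorem trNegMulLog_mul_comm' (X : Matrix ι κ ℂ) (Y : Matrix κ ι ℂ) :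
    trNegMulLog (X * Y) = trNegMulLog (Y * X) := by
  have h := congrArg (fun p : Polynomial ℂ => (p.roots.map fun z : ℂ => negMulLog z.re).sum)
    (charpoly_mul_comm' X Y)
  have hne : ∀ (k : ℕ) (p : Polynomial ℂ), p.Monic → Polynomial.X ^ k * p ≠ 0 := fun k p hp =>
    ((Polynomial.monic_X_pow k).mul hp).ne_zero
  rw [Polynomial.roots_mul (hne _ _ (charpoly_monic _)),
    Polynomial.roots_mul (hne _ _ (charpoly_monic _))] at h
  simpa [trNegMulLog, Polynomial.roots_pow, Multiset.map_nsmul, Multiset.sum_nsmul] using h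

theorem unitary_conjTranspose_mul_self (U : unitaryGroup ι ℂ) :
    (U : Matrix ι ι ℂ)ᴴ * (U : Matrix ι ι ℂ) = 1 := by
  simpa [star_eq_conjTranspose] using Unitary.coe_star_mul_self U

theorem unitary_mul_conjTranspose_self (U : unitaryGroup ι ℂ) :
    (U : Matrix ι ι ℂ) * (U : Matrix ι ι ℂ)ᴴ = 1 := by
  simpa [star_eq_conjTranspose] using Unitary.coe_mul_star_self U

theorem trNegMulLog_unitary_conj (U : unitaryGroup ι ℂ) (M : Matrix ι ι ℂ) :
    trNegMulLog ((U : Matrix ι ι ℂ) * M * (U : Matrix ι ι ℂ)ᴴ) = trNegMulLog M := by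
  rw [trNegMulLog_mul_comm, ← Matrix.mul_assoc, unitary_conjTranspose_mul_self, Matrix.one_mul]

theorem Matrix.IsHermitian.exists_unitary_diagonal {M : Matrix ι ι ℂ} (hM : M.IsHermitian) :
    ∃ U : unitaryGroup ι ℂ, M = (U : Matrix ι ι ℂ) *
      diagonal (fun i => ((hM.eigenvalues i : ℝ) : ℂ)) * (U : Matrix ι ι ℂ)ᴴ := by
  refine ⟨hM.eigenvectorUnitary, ?_⟩
  conv_lhs => rw [hM.spectral_theorem, Unitary.conjStarAlgAut_apply]
  rfl

theorem Matrix.IsHermitian.trNegMulLog_eq {M : Matrix ι ι ℂ} (hM : M.IsHermitian) :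
    trNegMulLog M = ∑ i, negMulLog (hM.eigenvalues i) := by
  obtain ⟨U, hU⟩ := hM.exists_unitary_diagonal
  conv_lhs => rw [hU, trNegMulLog_unitary_conj, trNegMulLog_diagonal]

theorem Matrix.PosSemidef.exists_unitary_diagonal {M : Matrix ι ι ℂ} (hM : M.PosSemidef) :
    ∃ (U : unitaryGroup ι ℂ) (d : ι → ℝ), (∀ i, 0 ≤ d i) ∧
      M = (U : Matrix ι ι ℂ) * diagonal (fun i => (d i : ℂ)) * (U : Matrix ι ι ℂ)ᴴ := by
  obtain ⟨U, hU⟩ := hM.isHermitian.exists_unitary_diagonal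
  exact ⟨U, _, hM.eigenvalues_nonneg, hU⟩

theorem trace_unitary_conj (U : unitaryGroup ι ℂ) (M : Matrix ι ι ℂ) :
    ((U : Matrix ι ι ℂ) * M * (U : Matrix ι ι ℂ)ᴴ).trace = M.trace := by
  rw [trace_mul_comm, ← Matrix.mul_assoc, unitary_conjTranspose_mul_self, Matrix.one_mul]

theorem sum_norm_sq_unitary_row (U : unitaryGroup ι ℂ) (i : ι) :
    ∑ j, ‖(U : Matrix ι ι ℂ) i j‖ ^ 2 = 1 := by
  have h := congrFun (congrFun (unitary_mul_conjTranspose_self U) i) i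
  simp only [mul_apply, conjTranspose_apply, one_apply_eq, RCLike.star_def,
    Complex.mul_conj, Complex.normSq_eq_norm_sq] at h
  exact_mod_cast h

theorem sum_norm_sq_unitary_col (U : unitaryGroup ι ℂ) (j : ι) :
    ∑ i, ‖(U : Matrix ι ι ℂ) i j‖ ^ 2 = 1 := by
  have h := congrFun (congrFun (unitary_conjTranspose_mul_self U) j) j
  simp only [mul_apply, conjTranspose_apply, one_apply_eq, RCLike.star_def,
    Complex.conj_mul'] at h
  exact_mod_cast h

theorem mul_diagonal_mul_conjTranspose_apply_self {m k : Type*} [Fintype k] [DecidableEq k]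
    (U : Matrix m k ℂ) (d : k → ℝ) (i : m) :
    (U * diagonal (fun i => (d i : ℂ)) * Uᴴ) i i = ((∑ j, ‖U i j‖ ^ 2 * d j : ℝ) : ℂ) := by
  rw [mul_apply]
  push_cast
  refine Finset.sum_congr rfl fun j _ => ?_
  rw [mul_diagonal, conjTranspose_apply, mul_right_comm, RCLike.star_def, Complex.mul_conj']

/-- **Peierls' inequality**: measuring in an orthonormal basis does not decrease the entropy. -/
theorem Matrix.PosSemidef.trNegMulLog_le_diag {M : Matrix ι ι ℂ} (hM : M.PosSemidef) :
    trNegMulLog M ≤ ∑ i, negMulLog (M i i).re := by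
  obtain ⟨U, d, hd, rfl⟩ := hM.exists_unitary_diagonal
  rw [trNegMulLog_unitary_conj, trNegMulLog_diagonal]
  have key : ∀ i, ∑ j, ‖(U : Matrix ι ι ℂ) i j‖ ^ 2 * negMulLog (d j) ≤
      negMulLog (∑ j, ‖(U : Matrix ι ι ℂ) i j‖ ^ 2 * d j) := fun i =>
    concaveOn_negMulLog.le_map_sum (t := Finset.univ)
      (fun j _ => by positivity) (sum_norm_sq_unitary_row U i) (fun j _ => hd j)
  calc ∑ j, negMulLog (d j)
      = ∑ j, (∑ i, ‖(U : Matrix ι ι ℂ) i j‖ ^ 2) * negMulLog (d j) := by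
        simp [sum_norm_sq_unitary_col]
    _ = ∑ i, ∑ j, ‖(U : Matrix ι ι ℂ) i j‖ ^ 2 * negMulLog (d j) := by
        simp only [Finset.sum_mul]
        exact Finset.sum_comm
    _ ≤ ∑ i, negMulLog (((U : Matrix ι ι ℂ) * diagonal (fun i => (d i : ℂ)) *
          (U : Matrix ι ι ℂ)ᴴ) i i).re := by
        refine Finset.sum_le_sum fun i _ => ?_
        rw [mul_diagonal_mul_conjTranspose_apply_self, Complex.ofReal_re]
        exact key i

theorem Matrix.PosSemidef.trNegMulLog_le_diag_conj {M : Matrix ι ι ℂ} (hM : M.PosSemidef)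
    (U : unitaryGroup ι ℂ) :
    trNegMulLog M ≤
      ∑ i, negMulLog (((U : Matrix ι ι ℂ)ᴴ * M * (U : Matrix ι ι ℂ)) i i).re := by
  have h := (hM.conjTranspose_mul_mul_same (U : Matrix ι ι ℂ)).trNegMulLog_le_diag
  have h2 := trNegMulLog_unitary_conj (star U) M
  rw [Unitary.coe_star, star_eq_conjTranspose, conjTranspose_conjTranspose] at h2
  rwa [h2] at h

/-- Equality in Peierls' inequality is attained in an eigenbasis. -/
theorem Matrix.IsHermitian.exists_trNegMulLog_eq_diag {M : Matrix ι ι ℂ} (hM : M.IsHermitian) :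
    ∃ U : unitaryGroup ι ℂ, trNegMulLog M =
      ∑ i, negMulLog (((U : Matrix ι ι ℂ)ᴴ * M * (U : Matrix ι ι ℂ)) i i).re := by
  obtain ⟨U, hU⟩ := hM.exists_unitary_diagonal
  refine ⟨U, ?_⟩
  have : (U : Matrix ι ι ℂ)ᴴ * M * (U : Matrix ι ι ℂ) =
      diagonal (fun i => ((hM.eigenvalues i : ℝ) : ℂ)) := by
    conv_lhs => rw [hU]
    rw [← Matrix.mul_assoc, ← Matrix.mul_assoc, unitary_conjTranspose_mul_self, Matrix.one_mul,
      Matrix.mul_assoc, unitary_conjTranspose_mul_self, Matrix.mul_one]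
  rw [hM.trNegMulLog_eq]
  refine Finset.sum_congr rfl fun i _ => ?_
  rw [this, diagonal_apply_eq, Complex.ofReal_re]

end Spectral

/-! ### Concavity, subadditivity and continuity of the entropy -/

section EntropyInequalities

variable {ι κ : Type*} [Fintype ι] [DecidableEq ι] [Fintype κ]

/-- Write `A k = X k * (X k)ᴴ` and let `X` have the columns of all the `X k`. Then `X * Xᴴ` is the
sum of the `A k`, while the diagonal of `Xᴴ * X` lists the eigenvalues of all the `A k`, and
Peierls' inequality compares the two. -/
theorem trNegMulLog_sum_le [DecidableEq κ] (A : κ → Matrix ι ι ℂ) (hA : ∀ k, (A k).PosSemidef) :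
    trNegMulLog (∑ k, A k) ≤ ∑ k, trNegMulLog (A k) := by
  choose U d hd hU using fun k => (hA k).exists_unitary_diagonal
  let X : Matrix ι (κ × ι) ℂ :=
    Matrix.of fun i kj => (U kj.1 : Matrix ι ι ℂ) i kj.2 * ((√(d kj.1 kj.2) : ℝ) : ℂ)
  have hsq : ∀ k j, ((√(d k j) : ℝ) : ℂ) * ((√(d k j) : ℝ) : ℂ) = (d k j : ℂ) := fun k j => by
    rw [← Complex.ofReal_mul, Real.mul_self_sqrt (hd k j)]
  have hX : X * Xᴴ = ∑ k, A k := by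
    ext i j
    rw [mul_apply, Fintype.sum_prod_type, Matrix.sum_apply]
    refine Finset.sum_congr rfl fun k _ => ?_
    conv_rhs => rw [hU k, mul_apply]
    refine Finset.sum_congr rfl fun l _ => ?_
    rw [mul_diagonal, conjTranspose_apply, conjTranspose_apply]
    simp only [X, Matrix.of_apply, star_mul', RCLike.star_def, Complex.conj_ofReal]
    rw [← hsq]
    ring
  have hdiag : ∀ kj, ((Xᴴ * X) kj kj).re = d kj.1 kj.2 := by
    rintro ⟨k, j⟩
    have : (Xᴴ * X) (k, j) (k, j) =
        ((∑ i, ‖(U k : Matrix ι ι ℂ) i j‖ ^ 2 * d k j : ℝ) : ℂ) := by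
      rw [mul_apply]
      push_cast
      refine Finset.sum_congr rfl fun i _ => ?_
      rw [conjTranspose_apply]
      simp only [X, Matrix.of_apply, star_mul', RCLike.star_def, Complex.conj_ofReal]
      rw [← Complex.conj_mul', ← hsq]
      ring
    rw [this, ← Finset.sum_mul, sum_norm_sq_unitary_col, one_mul, Complex.ofReal_re]
  rw [← hX, trNegMulLog_mul_comm']
  refine (posSemidef_conjTranspose_mul_self X).trNegMulLog_le_diag.trans_eq ?_
  simp only [hdiag, Fintype.sum_prod_type]
  refine Finset.sum_congr rfl fun k _ => ?_
  conv_rhs => rw [hU k, trNegMulLog_unitary_conj, trNegMulLog_diagonal]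

theorem trNegMulLog_add_le {A B : Matrix ι ι ℂ} (hA : A.PosSemidef) (hB : B.PosSemidef) :
    trNegMulLog (A + B) ≤ trNegMulLog A + trNegMulLog B := by
  have := trNegMulLog_sum_le ![A, B] (by simp [Fin.forall_fin_two, hA, hB])
  simpa [Fin.sum_univ_two] using this

theorem posSemidef_ofReal_smul {n : Type*} {A : Matrix n n ℂ} (hA : A.PosSemidef) {c : ℝ}
    (hc : 0 ≤ c) :
    ((c : ℂ) • A).PosSemidef :=
  hA.smul (by exact_mod_cast hc)

/-- Measure all the matrices in an eigenbasis of their mixture: Peierls' inequality bounds each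
term, and there is equality for the mixture. -/
theorem trNegMulLog_concave (A : κ → Matrix ι ι ℂ) (hA : ∀ k, (A k).PosSemidef) (w : κ → ℝ)
    (hw : ∀ k, 0 ≤ w k) (hw1 : ∑ k, w k = 1) :
    ∑ k, w k * trNegMulLog (A k) ≤ trNegMulLog (∑ k, (w k : ℂ) • A k) := by
  have hM : (∑ k, (w k : ℂ) • A k).PosSemidef :=
    posSemidef_sum _ fun k _ => posSemidef_ofReal_smul (hA k) (hw k)
  obtain ⟨U, hU⟩ := hM.isHermitian.exists_trNegMulLog_eq_diag
  have hlin : ∀ i, (((U : Matrix ι ι ℂ)ᴴ * (∑ k, (w k : ℂ) • A k) * (U : Matrix ι ι ℂ)) i i).re =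
      ∑ k, w k * (((U : Matrix ι ι ℂ)ᴴ * A k * (U : Matrix ι ι ℂ)) i i).re := fun i => by
    simp only [Matrix.mul_sum, Matrix.sum_mul, Matrix.mul_smul, Matrix.smul_mul, Matrix.sum_apply,
      Matrix.smul_apply, smul_eq_mul, Complex.re_sum, Complex.re_ofReal_mul]
  have hnn : ∀ k i, 0 ≤ (((U : Matrix ι ι ℂ)ᴴ * A k * (U : Matrix ι ι ℂ)) i i).re := fun k i =>
    (Complex.le_def.mp ((hA k).conjTranspose_mul_mul_same (U : Matrix ι ι ℂ)).diag_nonneg).1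
  rw [hU]
  calc ∑ k, w k * trNegMulLog (A k)
      ≤ ∑ k, w k * ∑ i, negMulLog (((U : Matrix ι ι ℂ)ᴴ * A k * (U : Matrix ι ι ℂ)) i i).re :=
        Finset.sum_le_sum fun k _ =>
          mul_le_mul_of_nonneg_left ((hA k).trNegMulLog_le_diag_conj U) (hw k)
    _ = ∑ i, ∑ k, w k * negMulLog (((U : Matrix ι ι ℂ)ᴴ * A k * (U : Matrix ι ι ℂ)) i i).re := by
        simp only [Finset.mul_sum]
        exact Finset.sum_comm
    _ ≤ _ := by
        refine Finset.sum_le_sum fun i _ => ?_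
        rw [hlin]
        exact concaveOn_negMulLog.le_map_sum (t := Finset.univ) (fun k _ => hw k) hw1
          (fun k _ => hnn k i)

theorem trNegMulLog_smul {A : Matrix ι ι ℂ} (hA : A.PosSemidef) (c : ℝ) :
    trNegMulLog ((c : ℂ) • A) = c * trNegMulLog A + negMulLog c * A.trace.re := by
  obtain ⟨U, d, -, rfl⟩ := hA.exists_unitary_diagonal
  have h : (c : ℂ) • diagonal (fun i => (d i : ℂ)) = diagonal fun i => ((c * d i : ℝ) : ℂ) := by
    ext i j
    by_cases hij : i = j <;> simp [diagonal, hij]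
  rw [← Matrix.smul_mul, ← Matrix.mul_smul, trNegMulLog_unitary_conj, trNegMulLog_unitary_conj, h,
    trNegMulLog_diagonal, trNegMulLog_diagonal, trace_unitary_conj, trace_diagonal,
    Complex.re_sum, Finset.mul_sum, Finset.mul_sum, ← Finset.sum_add_distrib]
  refine Finset.sum_congr rfl fun i _ => ?_
  rw [negMulLog_mul, Complex.ofReal_re]
  ring

theorem negMulLog_sub_le_negMulLog_add {a b t : ℝ} (ha : 0 ≤ a) (hb : 0 ≤ b)
    (hab : a + b ≤ 1 + t) : negMulLog a - b * (1 + t) ≤ negMulLog (a + b) := by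
  have key : b * log (a + b) ≤ b * t := by
    rcases hb.eq_or_lt with rfl | hb'
    · simp
    · exact mul_le_mul_of_nonneg_left
        ((log_le_sub_one_of_pos (by positivity)).trans (by linarith)) hb
  rcases ha.eq_or_lt with rfl | ha'
  · simp only [negMulLog, zero_add, neg_zero, zero_mul] at key ⊢
    linarith
  · have h1 : log ((a + b) / a) ≤ (a + b) / a - 1 := log_le_sub_one_of_pos (by positivity)
    rw [log_div (by positivity) ha'.ne'] at h1
    have h2 : a * (log (a + b) - log a) ≤ a * ((a + b) / a - 1) :=
      mul_le_mul_of_nonneg_left h1 ha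
    have h3 : a * ((a + b) / a - 1) = b := by
      field_simp
      ring
    simp only [negMulLog]
    linarith

theorem sum_re_diag_unitary_conj {A : Matrix ι ι ℂ} (U : unitaryGroup ι ℂ) :
    ∑ i, (((U : Matrix ι ι ℂ)ᴴ * A * (U : Matrix ι ι ℂ)) i i).re = A.trace.re := by
  have h := trace_unitary_conj (star U) A
  rw [Unitary.coe_star, star_eq_conjTranspose, conjTranspose_conjTranspose] at h
  rw [← h, Matrix.trace, Complex.re_sum]
  rfl

theorem trNegMulLog_sub_le_add {A X : Matrix ι ι ℂ} (hA : A.PosSemidef) (hX : X.PosSemidef)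
    {t : ℝ} (hA1 : A.trace.re = 1) (hXt : X.trace.re ≤ t) :
    trNegMulLog A - t * (1 + t) ≤ trNegMulLog (A + X) := by
  obtain ⟨U, hU⟩ := (hA.add hX).isHermitian.exists_trNegMulLog_eq_diag
  have hnn : ∀ {B : Matrix ι ι ℂ}, B.PosSemidef → ∀ i,
      0 ≤ (((U : Matrix ι ι ℂ)ᴴ * B * (U : Matrix ι ι ℂ)) i i).re := fun hB i =>
    (Complex.le_def.mp (hB.conjTranspose_mul_mul_same (U : Matrix ι ι ℂ)).diag_nonneg).1
  have hadd : ∀ i, (((U : Matrix ι ι ℂ)ᴴ * (A + X) * (U : Matrix ι ι ℂ)) i i).re =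
      (((U : Matrix ι ι ℂ)ᴴ * A * (U : Matrix ι ι ℂ)) i i).re +
      (((U : Matrix ι ι ℂ)ᴴ * X * (U : Matrix ι ι ℂ)) i i).re := fun i => by
    rw [Matrix.mul_add, Matrix.add_mul, Matrix.add_apply, Complex.add_re]
  have hsA := sum_re_diag_unitary_conj (A := A) U
  have hsX := sum_re_diag_unitary_conj (A := X) U
  have hX0 : 0 ≤ X.trace.re := (Complex.le_def.mp hX.trace_nonneg).1
  have hle : ∀ (B : Matrix ι ι ℂ), B.PosSemidef → ∀ i,
      (((U : Matrix ι ι ℂ)ᴴ * B * (U : Matrix ι ι ℂ)) i i).re ≤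
      ∑ j, (((U : Matrix ι ι ℂ)ᴴ * B * (U : Matrix ι ι ℂ)) j j).re := fun B hB i =>
    Finset.single_le_sum (f := fun j => (((U : Matrix ι ι ℂ)ᴴ * B * (U : Matrix ι ι ℂ)) j j).re)
      (fun j _ => hnn hB j) (Finset.mem_univ i)
  have hstep : ∑ i, (negMulLog (((U : Matrix ι ι ℂ)ᴴ * A * (U : Matrix ι ι ℂ)) i i).re -
      (((U : Matrix ι ι ℂ)ᴴ * X * (U : Matrix ι ι ℂ)) i i).re * (1 + t)) ≤
      trNegMulLog (A + X) := by
    rw [hU]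
    refine Finset.sum_le_sum fun i _ => ?_
    rw [hadd]
    refine negMulLog_sub_le_negMulLog_add (hnn hA i) (hnn hX i) ?_
    have h1 := hle A hA i
    have h2 := hle X hX i
    rw [hsA] at h1
    rw [hsX] at h2
    linarith
  rw [Finset.sum_sub_distrib, ← Finset.sum_mul, hsX] at hstep
  have h1 := hA.trNegMulLog_le_diag_conj U
  have h2 : X.trace.re * (1 + t) ≤ t * (1 + t) :=
    mul_le_mul_of_nonneg_right hXt (by linarith)
  linarith

theorem trNegMulLog_le {A : Matrix ι ι ℂ} (hA : A.PosSemidef) :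
    trNegMulLog A ≤ A.trace.re * log (Fintype.card ι) + 1 := by
  obtain ⟨U, d, hd, rfl⟩ := hA.exists_unitary_diagonal
  rw [trNegMulLog_unitary_conj, trNegMulLog_diagonal, trace_unitary_conj, trace_diagonal,
    Complex.re_sum]
  rcases isEmpty_or_nonempty ι with h | h
  · simp
  have hc : (0 : ℝ) < Fintype.card ι := by exact_mod_cast Fintype.card_pos
  have key : ∀ i, negMulLog (d i) ≤ d i * log (Fintype.card ι) + (Fintype.card ι : ℝ)⁻¹ := by
    intro i
    rcases (hd i).eq_or_lt with h0 | h0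
    · rw [← h0]
      simp
    · have h1 := log_le_sub_one_of_pos (x := (Fintype.card ι * d i)⁻¹) (by positivity)
      rw [log_inv, log_mul hc.ne' h0.ne'] at h1
      have h2 := mul_le_mul_of_nonneg_left h1 h0.le
      have h3 : d i * ((Fintype.card ι * d i)⁻¹ - 1) = (Fintype.card ι : ℝ)⁻¹ - d i := by
        field_simp
      rw [negMulLog]
      linarith
  refine (Finset.sum_le_sum fun i _ => key i).trans_eq ?_
  rw [Finset.sum_add_distrib, ← Finset.sum_mul]
  simp [hc.ne']

/-- A crude continuity estimate. The constant summand is harmless, since the entropies of `n`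
copies get divided by `n`. -/
theorem trNegMulLog_le_of_add_eq_add {A B X Y : Matrix ι ι ℂ} (hA : A.PosSemidef)
    (hB : B.PosSemidef) (hX : X.PosSemidef) (hY : Y.PosSemidef) {t : ℝ} (hA1 : A.trace.re = 1)
    (hXt : X.trace.re ≤ t) (hYt : Y.trace.re ≤ t) (h : A + X = B + Y) :
    trNegMulLog A ≤ trNegMulLog B + t * log (Fintype.card ι) + 1 + t * (1 + t) := by
  have h1 := trNegMulLog_sub_le_add hA hX hA1 hXt
  rw [h] at h1
  have h2 := trNegMulLog_add_le hB hY
  have h3 := trNegMulLog_le hY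
  have h4 : Y.trace.re * log (Fintype.card ι) ≤ t * log (Fintype.card ι) :=
    mul_le_mul_of_nonneg_right hYt (log_natCast_nonneg _)
  linarith

end EntropyInequalities

/-! ### Tensor powers and products of states -/

theorem sum_fin_succ_fun {ι M : Type*} [Fintype ι] [AddCommMonoid M] (n : ℕ)
    (F : (Fin (n + 1) → ι) → M) :
    ∑ x, F x = ∑ a, ∑ y : Fin n → ι, F (Fin.cons a y) := by
  rw [← Fintype.sum_prod_type' (f := fun a y => F (Fin.cons a y))]
  exact (Fintype.sum_equiv (Fin.consEquiv fun _ => ι) _ _ fun _ => rfl).symm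

theorem sum_prod_eq_one {ι : Type*} [Fintype ι] {p : ι → ℝ} (hp : ∑ i, p i = 1) (n : ℕ) :
    ∑ x : Fin n → ι, ∏ i, p (x i) = 1 := by
  rw [← Fintype.sum_pow, hp, one_pow]

theorem sum_negMulLog_prod {ι : Type*} [Fintype ι] {p : ι → ℝ} (hp : ∑ i, p i = 1) (n : ℕ) :
    ∑ x : Fin n → ι, negMulLog (∏ i, p (x i)) = n * ∑ i, negMulLog (p i) := by
  induction n with
  | zero => simp
  | succ n ih =>
    rw [sum_fin_succ_fun]
    simp only [Fin.prod_univ_succ, Fin.cons_zero, Fin.cons_succ, negMulLog_mul,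
      Finset.sum_add_distrib, ← Finset.mul_sum, ← Finset.sum_mul, ih, sum_prod_eq_one hp, hp]
    push_cast
    ring

/-- The `n`-fold tensor power of a matrix. -/
def powMat {ι κ : Type*} (M : Matrix ι κ ℂ) (n : ℕ) : Matrix (Fin n → ι) (Fin n → κ) ℂ :=
  Matrix.of fun x y => ∏ i, M (x i) (y i)

section PowMat

variable {ι : Type*}

theorem powMat_mul [Fintype ι] (M N : Matrix ι ι ℂ) (n : ℕ) :
    powMat (M * N) n = powMat M n * powMat N n := by
  ext x y
  simp only [powMat, Matrix.of_apply, mul_apply, Fintype.prod_sum, Finset.prod_mul_distrib]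

theorem powMat_conjTranspose (M : Matrix ι ι ℂ) (n : ℕ) : powMat Mᴴ n = (powMat M n)ᴴ := by
  ext x y
  simp [powMat, conjTranspose_apply]

theorem powMat_diagonal [DecidableEq ι] (d : ι → ℂ) (n : ℕ) :
    powMat (diagonal d) n = diagonal fun x => ∏ i, d (x i) := by
  ext x y
  by_cases h : x = y
  · subst h
    simp [powMat]
  · obtain ⟨i, hi⟩ := Function.ne_iff.mp h
    rw [diagonal_apply_ne _ h]
    exact Finset.prod_eq_zero (Finset.mem_univ i) (diagonal_apply_ne _ hi)

theorem powMat_one [DecidableEq ι] (n : ℕ) : powMat (1 : Matrix ι ι ℂ) n = 1 := by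
  rw [← diagonal_one, powMat_diagonal]
  simp

end PowMat

/-- `σ` is a tensor power `ρ^{⊗ n}`, up to a relabelling of the basis. -/
def QState.IsPow {ι κ : Type*} [Fintype ι] [DecidableEq ι] [Fintype κ] [DecidableEq κ]
    (σ : QState κ) (ρ : QState ι) (n : ℕ) : Prop :=
  ∃ e : κ ≃ (Fin n → ι), σ.mat = (powMat ρ.mat n).submatrix e e

namespace QState

section Spectral

variable {ι κ : Type*} [Fintype ι] [DecidableEq ι] [Fintype κ] [DecidableEq κ]

theorem ext_mat {ρ σ : QState ι} (h : ρ.mat = σ.mat) : ρ = σ := by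
  cases ρ
  cases σ
  cases h
  rfl

theorem entropy_eq (ρ : QState ι) : ρ.entropy = trNegMulLog ρ.mat / log 2 := by
  rw [entropy, ρ.posSemidef.isHermitian.trNegMulLog_eq, Finset.sum_div]
  refine Finset.sum_congr rfl fun i _ => ?_
  rw [negMulLog, Real.logb]
  ring

/-- A spectral decomposition of a state. -/
theorem exists_spectral (ρ : QState ι) :
    ∃ (U : unitaryGroup ι ℂ) (d : ι → ℝ), (∀ i, 0 ≤ d i) ∧ ∑ i, d i = 1 ∧
      ρ.mat = (U : Matrix ι ι ℂ) * diagonal (fun i => (d i : ℂ)) * (U : Matrix ι ι ℂ)ᴴ ∧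
      ρ.entropy * log 2 = ∑ i, negMulLog (d i) := by
  obtain ⟨U, d, hd, h⟩ := ρ.posSemidef.exists_unitary_diagonal
  refine ⟨U, d, hd, ?_, h, ?_⟩
  · have h1 := ρ.trace_eq_one
    rw [h, trace_unitary_conj, trace_diagonal] at h1
    exact_mod_cast h1
  · rw [entropy_eq, div_mul_cancel₀ _ (log_pos one_lt_two).ne', h, trNegMulLog_unitary_conj,
      trNegMulLog_diagonal]

/-- The spectral decomposition of a tensor power induced by one of the single factor. -/
theorem IsPow.exists_spectral {σ : QState κ} {n : ℕ} {e : κ ≃ (Fin n → ι)}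
    {M : Matrix ι ι ℂ} (he : σ.mat = (powMat M n).submatrix e e)
    {U : unitaryGroup ι ℂ} {d : ι → ℝ}
    (h : M = (U : Matrix ι ι ℂ) * diagonal (fun i => (d i : ℂ)) * (U : Matrix ι ι ℂ)ᴴ) :
    ∃ W : unitaryGroup κ ℂ, σ.mat = (W : Matrix κ κ ℂ) *
      diagonal (fun x => ((∏ i, d (e x i) : ℝ) : ℂ)) * (W : Matrix κ κ ℂ)ᴴ := by
  have hW : (powMat (U : Matrix ι ι ℂ) n).submatrix e e *
      star ((powMat (U : Matrix ι ι ℂ) n).submatrix e e) = 1 := by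
    rw [star_eq_conjTranspose, conjTranspose_submatrix, submatrix_mul_equiv,
      ← powMat_conjTranspose, ← powMat_mul, unitary_mul_conjTranspose_self, powMat_one,
      submatrix_one_equiv]
  refine ⟨⟨_, mem_unitaryGroup_iff.mpr hW⟩, ?_⟩
  rw [he, h, powMat_mul, powMat_mul, powMat_diagonal, powMat_conjTranspose]
  have : diagonal (fun x => ((∏ i, d (e x i) : ℝ) : ℂ)) =
      (diagonal fun x : Fin n → ι => ∏ i, (d (x i) : ℂ)).submatrix e e := by
    rw [submatrix_diagonal_equiv]
    congr 1
    ext x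
    simp
  rw [this, conjTranspose_submatrix, submatrix_mul_equiv, submatrix_mul_equiv]

theorem IsPow.entropy_eq {σ : QState κ} {ρ : QState ι} {n : ℕ} (h : σ.IsPow ρ n) :
    σ.entropy = n * ρ.entropy := by
  obtain ⟨e, he⟩ := h
  obtain ⟨U, d, hd, hd1, hU, hS⟩ := ρ.exists_spectral
  obtain ⟨W, hW⟩ := IsPow.exists_spectral he hU
  have hl := (log_pos one_lt_two).ne'
  rw [← mul_left_inj' hl, mul_assoc, hS, QState.entropy_eq, div_mul_cancel₀ _ hl, hW,
    trNegMulLog_unitary_conj, trNegMulLog_diagonal, ← sum_negMulLog_prod hd1]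
  exact Fintype.sum_equiv e _ _ fun x => rfl

end Spectral

section Copies

variable {α β γ : Type*} [Fintype α] [DecidableEq α] [Fintype β] [DecidableEq β]
  [Fintype γ] [DecidableEq γ]

/-- `n` independent copies of a tripartite state, with the systems grouped as `Aⁿ`, `Bⁿ`, `Cⁿ`. -/
def copies (ρ : QState (α × β × γ)) (n : ℕ) :
    QState ((Fin n → α) × (Fin n → β) × (Fin n → γ)) where
  mat := ρ.tensorPower n
  posSemidef := by
    obtain ⟨U, d, hd, h⟩ := ρ.posSemidef.exists_unitary_diagonal
    have h1 : (powMat ρ.mat n).PosSemidef := by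
      rw [h, powMat_mul, powMat_mul, powMat_conjTranspose, powMat_diagonal]
      refine (PosSemidef.diagonal fun x => ?_).mul_mul_conjTranspose_same _
      exact Finset.prod_nonneg fun i _ => Complex.zero_le_real.mpr (hd _)
    exact h1.submatrix fun (x : (Fin n → α) × (Fin n → β) × (Fin n → γ)) i =>
      (x.1 i, x.2.1 i, x.2.2 i)
  trace_eq_one := by
    have h := Fintype.sum_pow (fun a => ρ.mat a a) n
    have h1 : ∑ a, ρ.mat a a = 1 := ρ.trace_eq_one
    rw [h1, one_pow] at h
    rw [h]
    refine Fintype.sum_equiv ⟨fun x i => (x.1 i, x.2.1 i, x.2.2 i),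
      fun y => (fun i => (y i).1, fun i => (y i).2.1, fun i => (y i).2.2),
      fun _ => rfl, fun _ => rfl⟩ _ _ fun x => rfl

variable (ρ : QState (α × β × γ)) (n : ℕ)

theorem copies_isPow : (ρ.copies n).IsPow ρ n :=
  ⟨⟨fun x i => (x.1 i, x.2.1 i, x.2.2 i),
    fun y => (fun i => (y i).1, fun i => (y i).2.1, fun i => (y i).2.2),
    fun _ => rfl, fun _ => rfl⟩, rfl⟩

theorem copies_snd_isPow : (ρ.copies n).snd.IsPow ρ.snd n := by
  refine ⟨⟨fun x i => (x.1 i, x.2 i), fun y => (fun i => (y i).1, fun i => (y i).2),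
    fun _ => rfl, fun _ => rfl⟩, ?_⟩
  ext x y
  simp [snd, copies, tensorPower, ptraceLeft, powMat, Fintype.prod_sum]

theorem copies_fst_isPow : (ρ.copies n).fst.IsPow (fst (α := α) (β := β × γ) ρ) n := by
  refine ⟨Equiv.refl _, ?_⟩
  ext x y
  simp only [fst, copies, tensorPower, ptraceRight, powMat, Fintype.prod_sum, Matrix.of_apply,
    submatrix_apply, Equiv.refl_apply]
  exact Fintype.sum_equiv ⟨fun x i => (x.1 i, x.2 i),
    fun y => (fun i => (y i).1, fun i => (y i).2), fun _ => rfl, fun _ => rfl⟩ _ _ fun x => rfl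

theorem copies_snd_fst_isPow : (ρ.copies n).snd.fst.IsPow ρ.snd.fst n := by
  refine ⟨Equiv.refl _, ?_⟩
  ext x y
  simp only [fst, snd, copies, tensorPower, ptraceLeft, ptraceRight, powMat, Fintype.prod_sum,
    Matrix.of_apply, submatrix_apply, Equiv.refl_apply]

theorem copies_assoc_fst_isPow : (ρ.copies n).assoc.fst.IsPow ρ.assoc.fst n := by
  refine ⟨⟨fun x i => (x.1 i, x.2 i), fun y => (fun i => (y i).1, fun i => (y i).2),
    fun _ => rfl, fun _ => rfl⟩, ?_⟩
  ext x y
  simp [fst, assoc, copies, tensorPower, ptraceRight, powMat, Fintype.prod_sum]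

theorem copies_condMutualInfo : (ρ.copies n).condMutualInfo = n * ρ.condMutualInfo := by
  rw [condMutualInfo, condMutualInfo, (ρ.copies_isPow n).entropy_eq,
    (ρ.copies_snd_isPow n).entropy_eq, (ρ.copies_snd_fst_isPow n).entropy_eq,
    (ρ.copies_assoc_fst_isPow n).entropy_eq]
  ring

end Copies

section Prod

variable {α β γ : Type*} [Fintype α] [DecidableEq α] [Fintype β] [DecidableEq β]
  [Fintype γ] [DecidableEq γ]

/-- The product state `τ ⊗ σ`. -/
def prod (τ : QState α) (σ : QState β) : QState (α × β) where
  mat := τ.mat ⊗ₖ σ.mat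
  posSemidef := τ.posSemidef.kronecker σ.posSemidef
  trace_eq_one := by rw [trace_kronecker, τ.trace_eq_one, σ.trace_eq_one, one_mul]

theorem entropy_prod (τ : QState α) (σ : QState β) :
    (τ.prod σ).entropy = τ.entropy + σ.entropy := by
  obtain ⟨U, d, -, hd1, hU, hS⟩ := τ.exists_spectral
  obtain ⟨W, f, -, hf1, hW, hT⟩ := σ.exists_spectral
  have hl := (log_pos one_lt_two).ne'
  have hUW : (U : Matrix α α ℂ) ⊗ₖ (W : Matrix β β ℂ) ∈ unitaryGroup (α × β) ℂ :=
    kronecker_mem_unitary U.2 W.2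
  have h : (τ.prod σ).mat = ((⟨_, hUW⟩ : unitaryGroup (α × β) ℂ) : Matrix (α × β) (α × β) ℂ) *
      diagonal (fun x : α × β => ((d x.1 * f x.2 : ℝ) : ℂ)) *
      ((⟨_, hUW⟩ : unitaryGroup (α × β) ℂ) : Matrix (α × β) (α × β) ℂ)ᴴ := by
    have : diagonal (fun x : α × β => ((d x.1 * f x.2 : ℝ) : ℂ)) =
        diagonal (fun i => (d i : ℂ)) ⊗ₖ diagonal (fun i => (f i : ℂ)) := by
      rw [diagonal_kronecker_diagonal]
      simp
    rw [this, conjTranspose_kronecker, ← mul_kronecker_mul, ← mul_kronecker_mul, ← hU, ← hW]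
    rfl
  rw [← mul_left_inj' hl, add_mul, hS, hT, entropy_eq, div_mul_cancel₀ _ hl, h,
    trNegMulLog_unitary_conj, trNegMulLog_diagonal, Fintype.sum_prod_type]
  simp only [negMulLog_mul, Finset.sum_add_distrib, ← Finset.mul_sum, ← Finset.sum_mul, hd1, hf1,
    one_mul]

theorem prod_fst (τ : QState α) (σ : QState β) : (τ.prod σ).fst = τ := by
  refine ext_mat ?_
  ext i j
  have h : ∑ b, σ.mat b b = 1 := σ.trace_eq_one
  simp [fst, prod, ptraceRight, ← Finset.mul_sum, h]

theorem prod_snd (τ : QState α) (σ : QState β) : (τ.prod σ).snd = σ := by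
  refine ext_mat ?_
  ext i j
  have h : ∑ b, τ.mat b b = 1 := τ.trace_eq_one
  simp [snd, prod, ptraceLeft, ← Finset.sum_mul, h]

theorem prod_assoc_fst (τ : QState α) (σ : QState (β × γ)) :
    (τ.prod σ).assoc.fst = τ.prod σ.fst := by
  refine ext_mat ?_
  ext i j
  simp [fst, assoc, prod, ptraceRight, Finset.mul_sum]

theorem mutualInfo_prod (τ : QState α) (σ : QState β) : (τ.prod σ).mutualInfo = 0 := by
  rw [mutualInfo, entropy_prod, prod_fst, prod_snd, sub_self]

theorem isMarkov_prod (τ : QState α) (σ : QState (β × γ)) : (τ.prod σ).IsMarkov := by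
  rw [IsMarkov, condMutualInfo, prod_assoc_fst, prod_snd, entropy_prod, entropy_prod]
  ring

end Prod

end QState

/-! ### Mixtures of unitary conjugates -/

section Mixture

variable {ι α β γ : Type*} [Fintype ι] [DecidableEq ι] [Fintype α] [DecidableEq α]
  [Fintype β] [DecidableEq β] [Fintype γ] [DecidableEq γ] {N : ℕ}

/-- The uniform mixture of the unitary conjugates of a matrix. -/
noncomputable def unitaryAverage (U : Fin N → unitaryGroup ι ℂ) (M : Matrix ι ι ℂ) :
    Matrix ι ι ℂ :=
  (N : ℂ)⁻¹ • ∑ k, (U k : Matrix ι ι ℂ) * M * (U k : Matrix ι ι ℂ)ᴴ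

/-- The unitary `V ⊗ 1`. -/
def extendUnitary (β : Type*) [Fintype β] [DecidableEq β] (V : unitaryGroup α ℂ) :
    unitaryGroup (α × β) ℂ :=
  ⟨(V : Matrix α α ℂ) ⊗ₖ (1 : Matrix β β ℂ), kronecker_mem_unitary V.2 (one_mem _)⟩

theorem unitaryAverage_extendUnitary (V : Fin N → unitaryGroup α ℂ)
    (M : Matrix (α × β) (α × β) ℂ) :
    unitaryAverage (fun k => extendUnitary β (V k)) M = randomUnitary V M := rfl

theorem unitaryAverage_sub (U : Fin N → unitaryGroup ι ℂ) (M M' : Matrix ι ι ℂ) :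
    unitaryAverage U (M - M') = unitaryAverage U M - unitaryAverage U M' := by
  simp only [unitaryAverage, Matrix.mul_sub, Matrix.sub_mul, Finset.sum_sub_distrib, smul_sub]

theorem Matrix.IsHermitian.unitaryAverage {M : Matrix ι ι ℂ} (hM : M.IsHermitian)
    (U : Fin N → unitaryGroup ι ℂ) : (unitaryAverage U M).IsHermitian := by
  rw [IsHermitian, _root_.unitaryAverage, conjTranspose_smul, conjTranspose_sum]
  simp only [conjTranspose_mul, conjTranspose_conjTranspose, hM.eq, Matrix.mul_assoc]
  simp

theorem conj_extend_apply {α β : Type*} [Fintype α] [Fintype β] [DecidableEq β]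
    (V : Matrix α α ℂ) (M : Matrix (α × β) (α × β) ℂ) (i j : α × β) :
    ((V ⊗ₖ (1 : Matrix β β ℂ)) * M * (V ⊗ₖ (1 : Matrix β β ℂ))ᴴ) i j =
      ∑ y, ∑ x, V i.1 x * M (x, i.2) (y, j.2) * star (V j.1 y) := by
  rw [mul_apply, Fintype.sum_prod_type]
  refine Finset.sum_congr rfl fun y _ => ?_
  rw [Finset.sum_eq_single j.2]
  · rw [mul_apply, Fintype.sum_prod_type, Finset.sum_mul]
    refine Finset.sum_congr rfl fun x _ => ?_
    rw [Finset.sum_eq_single i.2]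
    · simp [conjTranspose_apply, kroneckerMap_apply]
    · intro b _ hb
      simp [kroneckerMap_apply, one_apply_ne hb.symm]
    · simp
  · intro b _ hb
    simp [conjTranspose_apply, kroneckerMap_apply, one_apply_ne hb.symm]
  · simp

theorem ptraceLeft_conj_extend (V : unitaryGroup α ℂ) (M : Matrix (α × β) (α × β) ℂ) :
    ptraceLeft (((V : Matrix α α ℂ) ⊗ₖ (1 : Matrix β β ℂ)) * M *
      ((V : Matrix α α ℂ) ⊗ₖ (1 : Matrix β β ℂ))ᴴ) = ptraceLeft M := by
  ext i j
  simp only [ptraceLeft, Matrix.of_apply, conj_extend_apply]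
  rw [Finset.sum_comm]
  refine Finset.sum_congr rfl fun y _ => ?_
  rw [Finset.sum_comm]
  have h : ∀ x, ∑ a, (V : Matrix α α ℂ) a x * M (x, i) (y, j) * star ((V : Matrix α α ℂ) a y) =
      M (x, i) (y, j) * (1 : Matrix α α ℂ) y x := fun x => by
    rw [← unitary_conjTranspose_mul_self V, mul_apply, Finset.mul_sum]
    refine Finset.sum_congr rfl fun a _ => ?_
    rw [conjTranspose_apply]
    ring
  simp only [h, one_apply, mul_ite, mul_one, mul_zero, Finset.sum_ite_eq, Finset.mem_univ, if_true]

theorem ptraceRight_conj_extend (V : unitaryGroup α ℂ) (M : Matrix (α × β) (α × β) ℂ) :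
    ptraceRight (((V : Matrix α α ℂ) ⊗ₖ (1 : Matrix β β ℂ)) * M *
      ((V : Matrix α α ℂ) ⊗ₖ (1 : Matrix β β ℂ))ᴴ) =
      (V : Matrix α α ℂ) * ptraceRight M * (V : Matrix α α ℂ)ᴴ := by
  ext i j
  simp only [ptraceRight, Matrix.of_apply, conj_extend_apply]
  simp only [mul_apply, Matrix.of_apply, Finset.sum_mul, Finset.mul_sum, conjTranspose_apply]
  rw [Finset.sum_comm]
  refine Finset.sum_congr rfl fun y _ => ?_
  rw [Finset.sum_comm]

namespace QState

/-- The mixture of the unitary conjugates of a state. -/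
noncomputable def mix (hN : 0 < N) (U : Fin N → unitaryGroup ι ℂ) (ρ : QState ι) : QState ι where
  mat := unitaryAverage U ρ.mat
  posSemidef := by
    refine PosSemidef.smul (posSemidef_sum _ fun k _ =>
      ρ.posSemidef.mul_mul_conjTranspose_same _) ?_
    simp
  trace_eq_one := by
    have hN' : (N : ℂ) ≠ 0 := by exact_mod_cast hN.ne'
    rw [unitaryAverage, trace_smul, trace_sum]
    simp [trace_unitary_conj, ρ.trace_eq_one, hN']

theorem mix_mat (hN : 0 < N) (U : Fin N → unitaryGroup ι ℂ) (ρ : QState ι) :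
    (mix hN U ρ).mat =
      ∑ k, (((N : ℝ)⁻¹ : ℝ) : ℂ) • ((U k : Matrix ι ι ℂ) * ρ.mat * (U k : Matrix ι ι ℂ)ᴴ) := by
  rw [← Finset.smul_sum]
  simp [mix, unitaryAverage]

theorem entropy_le_mix (hN : 0 < N) (U : Fin N → unitaryGroup ι ℂ) (ρ : QState ι) :
    ρ.entropy ≤ (mix hN U ρ).entropy := by
  have hN' : (N : ℝ) ≠ 0 := by exact_mod_cast hN.ne'
  rw [entropy_eq, entropy_eq, mix_mat]
  refine div_le_div_of_nonneg_right ?_ (log_pos one_lt_two).le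
  have h := trNegMulLog_concave
    (fun k => (U k : Matrix ι ι ℂ) * ρ.mat * (U k : Matrix ι ι ℂ)ᴴ)
    (fun k => ρ.posSemidef.mul_mul_conjTranspose_same _) (fun _ => (N : ℝ)⁻¹)
    (fun _ => by positivity) (by simp [hN'])
  simpa [trNegMulLog_unitary_conj, hN'] using h

theorem entropy_mix_le (hN : 0 < N) (U : Fin N → unitaryGroup ι ℂ) (ρ : QState ι) :
    (mix hN U ρ).entropy ≤ ρ.entropy + Real.logb 2 N := by
  have hN' : (N : ℝ) ≠ 0 := by exact_mod_cast hN.ne'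
  rw [entropy_eq, entropy_eq, mix_mat, Real.logb, ← add_div]
  refine div_le_div_of_nonneg_right ?_ (log_pos one_lt_two).le
  have hpsd := fun k => ρ.posSemidef.mul_mul_conjTranspose_same (U k : Matrix ι ι ℂ)
  refine (trNegMulLog_sum_le _ fun k =>
    posSemidef_ofReal_smul (hpsd k) (by positivity)).trans_eq ?_
  simp only [trNegMulLog_smul (hpsd _), trNegMulLog_unitary_conj, trace_unitary_conj,
    ρ.trace_eq_one, Finset.sum_const, Finset.card_univ, Fintype.card_fin, nsmul_eq_mul, negMulLog,
    Complex.one_re, log_inv]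
  field_simp

variable (hN : 0 < N) (V : Fin N → unitaryGroup α ℂ)

theorem mix_extend_snd (ρ : QState (α × β)) :
    (mix hN (fun k => extendUnitary β (V k)) ρ).snd = ρ.snd := by
  have hN' : (N : ℂ) ≠ 0 := by exact_mod_cast hN.ne'
  refine ext_mat ?_
  have h : ∀ i j k, ∑ a, ((extendUnitary β (V k) : Matrix (α × β) (α × β) ℂ) * ρ.mat *
      (extendUnitary β (V k) : Matrix (α × β) (α × β) ℂ)ᴴ) (a, i) (a, j) =
      ρ.snd.mat i j := fun i j k =>
    congrFun (congrFun (ptraceLeft_conj_extend (V k) ρ.mat) i) j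
  ext i j
  simp only [snd, mix, unitaryAverage, ptraceLeft, Matrix.of_apply, Matrix.smul_apply,
    Matrix.sum_apply, smul_eq_mul, ← Finset.mul_sum]
  rw [Finset.sum_comm]
  simp only [h, Finset.sum_const, Finset.card_univ, Fintype.card_fin, nsmul_eq_mul]
  rw [inv_mul_cancel_left₀ hN']
  rfl

theorem mix_extend_fst (ρ : QState (α × β)) :
    (mix hN (fun k => extendUnitary β (V k)) ρ).fst = mix hN V ρ.fst := by
  refine ext_mat ?_
  have h : ∀ i j k, ∑ b, ((extendUnitary β (V k) : Matrix (α × β) (α × β) ℂ) * ρ.mat *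
      (extendUnitary β (V k) : Matrix (α × β) (α × β) ℂ)ᴴ) (i, b) (j, b) =
      ((V k : Matrix α α ℂ) * ptraceRight ρ.mat * (V k : Matrix α α ℂ)ᴴ) i j := fun i j k =>
    congrFun (congrFun (ptraceRight_conj_extend (V k) ρ.mat) i) j
  ext i j
  simp only [fst, mix, unitaryAverage, ptraceRight, Matrix.of_apply, Matrix.smul_apply,
    Matrix.sum_apply, smul_eq_mul, ← Finset.mul_sum]
  rw [Finset.sum_comm]
  simp only [h]
  rfl

theorem mix_extend_assoc_fst (ρ : QState (α × β × γ)) :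
    (mix hN (fun k => extendUnitary (β × γ) (V k)) ρ).assoc.fst =
      mix hN (fun k => extendUnitary β (V k)) ρ.assoc.fst := by
  refine ext_mat ?_
  ext ⟨a, b⟩ ⟨a', b'⟩
  simp only [fst, mix, assoc, unitaryAverage, ptraceRight, Matrix.of_apply, Matrix.smul_apply,
    Matrix.sum_apply, smul_eq_mul, ← Finset.mul_sum, extendUnitary, conj_extend_apply,
    submatrix_apply, Equiv.prodAssoc_apply]
  congr 1
  rw [Finset.sum_comm]
  refine Finset.sum_congr rfl fun k _ => ?_
  rw [Finset.sum_comm]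
  refine Finset.sum_congr rfl fun y _ => ?_
  rw [Finset.sum_comm]
  simp only [Finset.mul_sum, Finset.sum_mul]

end QState

end Mixture

/-! ### Closeness of states and the trace norm -/

section TraceNorm

variable {ι : Type*} [Fintype ι] [DecidableEq ι]

theorem Matrix.IsHermitian.sum_eigenvalues_eq {M : Matrix ι ι ℂ} (hM : M.IsHermitian)
    {U : unitaryGroup ι ℂ} {d : ι → ℝ}
    (h : M = (U : Matrix ι ι ℂ) * diagonal (fun i => (d i : ℂ)) * (U : Matrix ι ι ℂ)ᴴ)
    (f : ℝ → ℝ) : ∑ i, f (hM.eigenvalues i) = ∑ i, f (d i) := by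
  have h1 : M.charpoly = (diagonal fun i => (d i : ℂ)).charpoly := by
    rw [h, charpoly_mul_comm, ← Matrix.mul_assoc, unitary_conjTranspose_mul_self, Matrix.one_mul]
  have h2 := hM.roots_charpoly_eq_eigenvalues
  rw [h1, charpoly_diagonal, Polynomial.roots_prod _ _ (by
    exact Finset.prod_ne_zero_iff.mpr fun i _ => Polynomial.X_sub_C_ne_zero _)] at h2
  have h3 := congrArg (fun s : Multiset ℂ => (s.map fun z => f z.re).sum) h2
  simpa [Finset.sum_map_val] using h3.symm

theorem Matrix.IsHermitian.traceNorm_eq {H : Matrix ι ι ℂ} (hH : H.IsHermitian) :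
    traceNorm H = ∑ i, |hH.eigenvalues i| := by
  obtain ⟨U, hU⟩ := hH.exists_unitary_diagonal
  have h : Hᴴ * H = (U : Matrix ι ι ℂ) *
      diagonal (fun i => ((hH.eigenvalues i ^ 2 : ℝ) : ℂ)) * (U : Matrix ι ι ℂ)ᴴ := by
    have hd : diagonal (fun i => ((hH.eigenvalues i ^ 2 : ℝ) : ℂ)) =
        diagonal (fun i => ((hH.eigenvalues i : ℝ) : ℂ)) *
          diagonal (fun i => ((hH.eigenvalues i : ℝ) : ℂ)) := by
      rw [diagonal_mul_diagonal]
      simp [sq]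
    rw [hH.eq, hd]
    conv_lhs => rw [hU]
    simp only [Matrix.mul_assoc]
    rw [← Matrix.mul_assoc (U : Matrix ι ι ℂ)ᴴ, unitary_conjTranspose_mul_self, Matrix.one_mul]
  rw [traceNorm, (isHermitian_conjTranspose_mul_self H).sum_eigenvalues_eq h (fun x => √x)]
  simp only [Real.sqrt_sq_eq_abs]

/-- The trace norm of `H` is at most `b`, in dual form: `|Tr (U H)| ≤ b` for every unitary `U`.
In this form the triangle inequality and the invariance under unitaries are immediate. -/
def TraceNormLE (H : Matrix ι ι ℂ) (b : ℝ) : Prop :=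
  ∀ U : unitaryGroup ι ℂ, ‖((U : Matrix ι ι ℂ) * H).trace‖ ≤ b

theorem TraceNormLE.add {H H' : Matrix ι ι ℂ} {b b' : ℝ} (h : TraceNormLE H b)
    (h' : TraceNormLE H' b') : TraceNormLE (H + H') (b + b') := fun U => by
  rw [Matrix.mul_add, trace_add]
  exact (norm_add_le _ _).trans (add_le_add (h U) (h' U))

theorem TraceNormLE.mono {H : Matrix ι ι ℂ} {b b' : ℝ} (h : TraceNormLE H b) (hb : b ≤ b') :
    TraceNormLE H b' := fun U => (h U).trans hb

theorem TraceNormLE.unitary_conj {H : Matrix ι ι ℂ} {b : ℝ} (h : TraceNormLE H b)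
    (W : unitaryGroup ι ℂ) :
    TraceNormLE ((W : Matrix ι ι ℂ) * H * (W : Matrix ι ι ℂ)ᴴ) b := fun U => by
  have := h (star W * U * W)
  rwa [Submonoid.coe_mul, Submonoid.coe_mul, Unitary.coe_star, star_eq_conjTranspose,
    Matrix.mul_assoc, Matrix.mul_assoc, trace_mul_comm, Matrix.mul_assoc] at this

theorem TraceNormLE.unitaryAverage {H : Matrix ι ι ℂ} {b : ℝ} (h : TraceNormLE H b) {N : ℕ}
    (hN : 0 < N) (V : Fin N → unitaryGroup ι ℂ) : TraceNormLE (unitaryAverage V H) b := fun U => by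
  have hN' : (0 : ℝ) < N := by exact_mod_cast hN
  rw [_root_.unitaryAverage, Matrix.mul_smul, trace_smul, Matrix.mul_sum, trace_sum, norm_smul,
    norm_inv, Complex.norm_natCast, inv_mul_le_iff₀ hN']
  refine (norm_sum_le _ _).trans ((Finset.sum_le_sum fun k _ => h.unitary_conj (V k) U).trans ?_)
  simp

/-- The sign of `H` is a unitary that attains the trace norm. -/
theorem Matrix.IsHermitian.traceNorm_le {H : Matrix ι ι ℂ} (hH : H.IsHermitian) {b : ℝ}
    (h : TraceNormLE H b) : traceNorm H ≤ b := by
  obtain ⟨U, hU⟩ := hH.exists_unitary_diagonal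
  let s : ι → ℂ := fun i => if 0 ≤ hH.eigenvalues i then 1 else -1
  have hs : diagonal s ∈ unitaryGroup ι ℂ := by
    rw [mem_unitaryGroup_iff, star_eq_conjTranspose, diagonal_conjTranspose,
      diagonal_mul_diagonal, ← diagonal_one]
    congr 1
    ext i
    by_cases hi : 0 ≤ hH.eigenvalues i <;> simp [s, hi]
  have h1 := h (U * ⟨_, hs⟩ * star U)
  have h2 : ((U : Matrix ι ι ℂ) * diagonal s * (U : Matrix ι ι ℂ)ᴴ * H).trace =
      ((∑ i, |hH.eigenvalues i| : ℝ) : ℂ) := by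
    conv_lhs => rw [hU]
    simp only [← Matrix.mul_assoc]
    rw [Matrix.mul_assoc ((U : Matrix ι ι ℂ) * diagonal s), unitary_conjTranspose_mul_self,
      Matrix.mul_one, Matrix.mul_assoc (U : Matrix ι ι ℂ), diagonal_mul_diagonal,
      trace_unitary_conj, trace_diagonal]
    push_cast
    refine Finset.sum_congr rfl fun i _ => ?_
    by_cases hi : 0 ≤ hH.eigenvalues i
    · simp [s, hi, abs_of_nonneg hi]
    · simp [s, hi, abs_of_neg (not_le.mp hi)]
  rw [Submonoid.coe_mul, Submonoid.coe_mul, Unitary.coe_star, star_eq_conjTranspose, h2,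
    Complex.norm_real, Real.norm_of_nonneg (Finset.sum_nonneg fun i _ => abs_nonneg _)] at h1
  rwa [hH.traceNorm_eq]

/-- `ρ` and `σ` differ by two positive semidefinite matrices of trace at most `t`. -/
def QState.Near (ρ σ : QState ι) (t : ℝ) : Prop :=
  ∃ X Y : Matrix ι ι ℂ, X.PosSemidef ∧ Y.PosSemidef ∧ X.trace.re ≤ t ∧ Y.trace.re ≤ t ∧
    ρ.mat + X = σ.mat + Y

namespace QState

/-- Take the negative and positive parts of `ρ - σ`. -/
theorem near_of_traceNorm_le {ρ σ : QState ι} {t : ℝ} (h : traceNorm (ρ.mat - σ.mat) ≤ t) :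
    ρ.Near σ t := by
  have hH : (ρ.mat - σ.mat).IsHermitian := ρ.posSemidef.isHermitian.sub σ.posSemidef.isHermitian
  rw [hH.traceNorm_eq] at h
  obtain ⟨U, hU⟩ := hH.exists_unitary_diagonal
  have hpsd : ∀ d : ι → ℝ, (∀ i, 0 ≤ d i) → ((U : Matrix ι ι ℂ) *
      diagonal (fun i => (d i : ℂ)) * (U : Matrix ι ι ℂ)ᴴ).PosSemidef := fun d hd =>
    (PosSemidef.diagonal fun i => Complex.zero_le_real.mpr (hd i)).mul_mul_conjTranspose_same _
  have htr : ∀ d : ι → ℝ, (∀ i, d i ≤ |hH.eigenvalues i|) → ((U : Matrix ι ι ℂ) *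
      diagonal (fun i => (d i : ℂ)) * (U : Matrix ι ι ℂ)ᴴ).trace.re ≤ t := fun d hd => by
    rw [trace_unitary_conj, trace_diagonal, Complex.re_sum]
    exact (Finset.sum_le_sum fun i _ => hd i).trans h
  refine ⟨_, _, hpsd (fun i => (hH.eigenvalues i)⁻) (fun i => negPart_nonneg _),
    hpsd (fun i => (hH.eigenvalues i)⁺) (fun i => posPart_nonneg _),
    htr _ (fun i => max_le (neg_le_abs _) (abs_nonneg _)),
    htr _ (fun i => max_le (le_abs_self _) (abs_nonneg _)), ?_⟩
  rw [add_comm σ.mat, ← sub_eq_sub_iff_add_eq_add, ← Matrix.sub_mul, ← Matrix.mul_sub, diagonal_sub]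
  conv_lhs => rw [hU]
  congr! with i
  rw [← Complex.ofReal_sub, posPart_sub_negPart]

theorem Near.symm {ρ σ : QState ι} {t : ℝ} (h : ρ.Near σ t) : σ.Near ρ t := by
  obtain ⟨X, Y, hX, hY, hXt, hYt, h⟩ := h
  exact ⟨Y, X, hY, hX, hYt, hXt, h.symm⟩

theorem Near.entropy_le {ρ σ : QState ι} {t : ℝ} (h : ρ.Near σ t) :
    ρ.entropy ≤ σ.entropy + (t * log (Fintype.card ι) + 1 + t * (1 + t)) / log 2 := by
  obtain ⟨X, Y, hX, hY, hXt, hYt, h⟩ := h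
  have h1 := trNegMulLog_le_of_add_eq_add ρ.posSemidef σ.posSemidef hX hY
    (by rw [ρ.trace_eq_one, Complex.one_re]) hXt hYt h
  rw [entropy_eq, entropy_eq, ← add_div]
  exact div_le_div_of_nonneg_right (by linarith) (log_pos one_lt_two).le

variable {α β γ : Type*} [Fintype α] [DecidableEq α] [Fintype β] [DecidableEq β]
  [Fintype γ] [DecidableEq γ]

theorem Near.fst {ρ σ : QState (α × β)} {t : ℝ} (h : ρ.Near σ t) : ρ.fst.Near σ.fst t := by
  obtain ⟨X, Y, hX, hY, hXt, hYt, h⟩ := h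
  refine ⟨ptraceRight X, ptraceRight Y, ptraceRight_posSemidef hX, ptraceRight_posSemidef hY,
    ?_, ?_, ?_⟩
  · simpa [Matrix.trace, ptraceRight, Fintype.sum_prod_type] using hXt
  · simpa [Matrix.trace, ptraceRight, Fintype.sum_prod_type] using hYt
  · ext i j
    simp only [QState.fst, ptraceRight, Matrix.add_apply, Matrix.of_apply,
      ← Finset.sum_add_distrib]
    exact Finset.sum_congr rfl fun b _ => congrFun (congrFun h (i, b)) (j, b)

theorem Near.snd {ρ σ : QState (α × β)} {t : ℝ} (h : ρ.Near σ t) : ρ.snd.Near σ.snd t := by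
  obtain ⟨X, Y, hX, hY, hXt, hYt, h⟩ := h
  refine ⟨ptraceLeft X, ptraceLeft Y, ptraceLeft_posSemidef hX, ptraceLeft_posSemidef hY,
    ?_, ?_, ?_⟩
  · simpa [Matrix.trace, ptraceLeft, Fintype.sum_prod_type_right] using hXt
  · simpa [Matrix.trace, ptraceLeft, Fintype.sum_prod_type_right] using hYt
  · ext i j
    simp only [QState.snd, ptraceLeft, Matrix.add_apply, Matrix.of_apply,
      ← Finset.sum_add_distrib]
    exact Finset.sum_congr rfl fun b _ => congrFun (congrFun h (b, i)) (b, j)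

theorem Near.assoc {ρ σ : QState (α × β × γ)} {t : ℝ} (h : ρ.Near σ t) :
    ρ.assoc.Near σ.assoc t := by
  obtain ⟨X, Y, hX, hY, hXt, hYt, h⟩ := h
  have htr : ∀ M : Matrix (α × β × γ) (α × β × γ) ℂ,
      (M.submatrix (Equiv.prodAssoc α β γ) (Equiv.prodAssoc α β γ)).trace = M.trace := fun M =>
    Fintype.sum_equiv (Equiv.prodAssoc α β γ) _ _ fun _ => rfl
  refine ⟨_, _, hX.submatrix _, hY.submatrix _, (htr X).symm ▸ hXt, (htr Y).symm ▸ hYt, ?_⟩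
  ext i j
  exact congrFun (congrFun h _) _

end QState

end TraceNorm

/-! ### Lower bounds on the randomness cost -/

namespace QState

section Converse

variable {α β γ : Type*} [Fintype α] [DecidableEq α] [Fintype β] [DecidableEq β]
  [Fintype γ] [DecidableEq γ]

theorem nonempty {ι : Type*} [Fintype ι] [DecidableEq ι] (ρ : QState ι) : Nonempty ι := by
  by_contra h
  rw [not_nonempty_iff] at h
  have := ρ.trace_eq_one
  simp [Matrix.trace] at this

theorem assoc_fst_fst (ρ : QState (α × β × γ)) :
    ρ.assoc.fst.fst = fst (α := α) (β := β × γ) ρ := by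
  refine ext_mat ?_
  ext i j
  simp [fst, assoc, ptraceRight, Fintype.sum_prod_type]

theorem assoc_fst_snd (ρ : QState (α × β × γ)) : ρ.assoc.fst.snd = ρ.snd.fst := by
  refine ext_mat ?_
  ext i j
  simp only [fst, snd, assoc, ptraceRight, ptraceLeft, Matrix.of_apply, submatrix_apply,
    Equiv.prodAssoc_apply]
  exact Finset.sum_comm

/-- The chain rule `I(A:C|B) = I(A:BC) - I(A:B)`. -/
theorem condMutualInfo_eq_sub (ρ : QState (α × β × γ)) :
    ρ.condMutualInfo = mutualInfo (α := α) (β := β × γ) ρ - ρ.assoc.fst.mutualInfo := by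
  rw [condMutualInfo, mutualInfo, mutualInfo, assoc_fst_fst, assoc_fst_snd]
  ring

theorem mutualInfo_sub_logb_le_mix (ρ : QState (α × β)) {N : ℕ} (hN : 0 < N)
    (V : Fin N → unitaryGroup α ℂ) :
    ρ.mutualInfo - Real.logb 2 N ≤ (mix hN (fun k => extendUnitary β (V k)) ρ).mutualInfo := by
  rw [mutualInfo, mutualInfo, mix_extend_fst, mix_extend_snd]
  have h1 := entropy_le_mix hN V ρ.fst
  have h2 := entropy_mix_le hN (fun k => extendUnitary β (V k)) ρ
  linarith

/-- The marginals on `BC` and `B` do not change, the entropy of `AB` does not decrease, and that of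
`ABC` increases by at most `log N`. -/
theorem condMutualInfo_sub_logb_le_mix (ρ : QState (α × β × γ)) {N : ℕ} (hN : 0 < N)
    (V : Fin N → unitaryGroup α ℂ) :
    ρ.condMutualInfo - Real.logb 2 N ≤
      (mix hN (fun k => extendUnitary (β × γ) (V k)) ρ).condMutualInfo := by
  rw [condMutualInfo, condMutualInfo, mix_extend_assoc_fst, mix_extend_snd]
  have h1 := entropy_le_mix hN (fun k => extendUnitary β (V k)) ρ.assoc.fst
  have h2 := entropy_mix_le hN (fun k => extendUnitary (β × γ) (V k)) ρ
  linarith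

theorem Near.entropy_le_of_log_card_le {ι : Type*} [Fintype ι] [DecidableEq ι] {ρ σ : QState ι}
    {t L : ℝ} (ht : 0 ≤ t) (h : ρ.Near σ t) (hL : log (Fintype.card ι) ≤ L) :
    ρ.entropy ≤ σ.entropy + (t * L + 1 + t * (1 + t)) / log 2 := by
  refine h.entropy_le.trans ?_
  have h1 : t * log (Fintype.card ι) ≤ t * L := mul_le_mul_of_nonneg_left hL ht
  have h2 : (t * log (Fintype.card ι) + 1 + t * (1 + t)) / log 2 ≤
      (t * L + 1 + t * (1 + t)) / log 2 :=
    div_le_div_of_nonneg_right (by linarith) (log_pos one_lt_two).le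
  linarith

theorem log_card_prod_left_le {α β : Type*} [Fintype α] [Fintype β] [Nonempty α] [Nonempty β] :
    log (Fintype.card α) ≤ log (Fintype.card (α × β)) := by
  refine log_le_log (by exact_mod_cast Fintype.card_pos) ?_
  rw [Fintype.card_prod]
  exact_mod_cast Nat.le_mul_of_pos_right _ Fintype.card_pos

theorem log_card_prod_right_le {α β : Type*} [Fintype α] [Fintype β] [Nonempty α] [Nonempty β] :
    log (Fintype.card β) ≤ log (Fintype.card (α × β)) := by
  refine log_le_log (by exact_mod_cast Fintype.card_pos) ?_
  rw [Fintype.card_prod]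
  exact_mod_cast Nat.le_mul_of_pos_left _ Fintype.card_pos

theorem Near.mutualInfo_le {ρ σ : QState (α × β)} {t : ℝ} (ht : 0 ≤ t) (h : ρ.Near σ t) :
    ρ.mutualInfo ≤ σ.mutualInfo +
      4 * ((t * log (Fintype.card (α × β)) + 1 + t * (1 + t)) / log 2) := by
  have := ρ.fst.nonempty
  have := ρ.snd.nonempty
  have h1 := h.symm.entropy_le_of_log_card_le ht le_rfl
  have h2 := h.fst.entropy_le_of_log_card_le ht (log_card_prod_left_le (α := α) (β := β))
  have h3 := h.snd.entropy_le_of_log_card_le ht (log_card_prod_right_le (α := α) (β := β))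
  have h4 : 0 ≤ (t * log (Fintype.card (α × β)) + 1 + t * (1 + t)) / log 2 := by
    have := log_natCast_nonneg (Fintype.card (α × β))
    have := (log_pos one_lt_two).le
    positivity
  rw [mutualInfo, mutualInfo]
  linarith

theorem Near.condMutualInfo_le {ρ σ : QState (α × β × γ)} {t : ℝ} (ht : 0 ≤ t)
    (h : ρ.Near σ t) :
    ρ.condMutualInfo ≤ σ.condMutualInfo +
      4 * ((t * log (Fintype.card (α × β × γ)) + 1 + t * (1 + t)) / log 2) := by
  have := (QState.fst (α := α) (β := β × γ) ρ).nonempty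
  have := ρ.snd.fst.nonempty
  have := ρ.snd.snd.nonempty
  have h1 := h.symm.entropy_le_of_log_card_le ht le_rfl
  have h2 := h.snd.entropy_le_of_log_card_le ht (log_card_prod_right_le (α := α) (β := β × γ))
  have h3 := h.snd.fst.symm.entropy_le_of_log_card_le ht
    ((log_card_prod_left_le (α := β) (β := γ)).trans (log_card_prod_right_le (α := α)))
  have h4 := h.assoc.fst.entropy_le_of_log_card_le ht
    ((log_card_prod_left_le (α := α × β) (β := γ)).trans_eq
      (by rw [Fintype.card_congr (Equiv.prodAssoc α β γ)]))
  rw [condMutualInfo, condMutualInfo]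
  linarith

/-- `ρ` is decoupled on `A` with the randomness cost `R`: random unitaries on `Aⁿ` asymptotically
turn `ρ^{⊗ n}` into a product state of `Aⁿ` and `BⁿCⁿ`. -/
def IsDecoupledWith (ρ : QState (α × β × γ)) (R : ℝ) : Prop :=
  ∀ ε : ℝ, 0 < ε → ∃ n₀ : ℕ, ∀ n : ℕ, n₀ ≤ n →
    0 < ⌊(2 : ℝ) ^ ((n : ℝ) * R)⌋₊ ∧
    ∃ (V : Fin ⌊(2 : ℝ) ^ ((n : ℝ) * R)⌋₊ → Matrix.unitaryGroup (Fin n → α) ℂ)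
      (τ : QState (Fin n → α)) (σ : QState ((Fin n → β) × (Fin n → γ))),
      traceNorm (randomUnitary V (ρ.tensorPower n) - (τ.prod σ).mat) ≤ ε

theorem IsDecoupledWith.isMarkovianizedWith {ρ : QState (α × β × γ)} {R : ℝ}
    (h : ρ.IsDecoupledWith R) : IsMarkovianizedWith ρ R := by
  intro ε hε
  obtain ⟨n₀, hn₀⟩ := h ε hε
  refine ⟨n₀, fun n hn => ?_⟩
  obtain ⟨hN, V, τ, σ, hV⟩ := hn₀ n hn
  exact ⟨hN, V, τ.prod σ, isMarkov_prod τ σ, hV⟩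

/-- A bound per `n` copies passes to the limit `n → ∞`, then `ε → 0`. -/
theorem le_of_forall_mul_le_add {I R K L : ℝ} (hK : 0 ≤ K) (hL : 0 ≤ L)
    (h : ∀ ε : ℝ, 0 < ε → ∃ n₀ : ℕ, ∀ n : ℕ, n₀ ≤ n →
      n * I ≤ n * R + K * (ε * (n * L) + 1 + ε * (1 + ε))) : I ≤ R := by
  by_contra! hlt
  obtain ⟨ε, hε, hεK⟩ : ∃ ε : ℝ, 0 < ε ∧ K * (ε * L) ≤ (I - R) / 2 := by
    refine ⟨(I - R) / 2 / (K * L + 1), by have := sub_pos.mpr hlt; positivity, ?_⟩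
    have h1 : K * L / (K * L + 1) ≤ 1 := div_le_one_of_le₀ (by linarith) (by positivity)
    calc K * ((I - R) / 2 / (K * L + 1) * L) = (I - R) / 2 * (K * L / (K * L + 1)) := by ring
      _ ≤ (I - R) / 2 * 1 := mul_le_mul_of_nonneg_left h1 (by linarith)
      _ = _ := mul_one _
  obtain ⟨n₀, hn₀⟩ := h ε hε
  obtain ⟨m, hm⟩ := exists_nat_gt (K * (1 + ε * (1 + ε)) / ((I - R) / 2))
  have hn := hn₀ (max n₀ m) (le_max_left _ _)
  have hm' : (m : ℝ) ≤ (max n₀ m : ℕ) := by exact_mod_cast le_max_right _ _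
  set n : ℝ := ((max n₀ m : ℕ) : ℝ) with hn_def
  rw [div_lt_iff₀ (by linarith)] at hm
  have h1 : (m : ℝ) * ((I - R) / 2) ≤ n * ((I - R) / 2) :=
    mul_le_mul_of_nonneg_right hm' (by linarith)
  have h2 : n * (K * (ε * L)) ≤ n * ((I - R) / 2) :=
    mul_le_mul_of_nonneg_left hεK (Nat.cast_nonneg _)
  linarith

theorem logb_floor_rpow_le {x : ℝ} (h : 0 < ⌊(2 : ℝ) ^ x⌋₊) :
    Real.logb 2 (⌊(2 : ℝ) ^ x⌋₊ : ℝ) ≤ x := by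
  rw [Real.logb_le_iff_le_rpow one_lt_two (by exact_mod_cast h)]
  exact Nat.floor_le (by positivity)

theorem card_copies (α β γ : Type*) [Fintype α] [Fintype β] [Fintype γ] (n : ℕ) :
    log (Fintype.card ((Fin n → α) × (Fin n → β) × (Fin n → γ))) =
      n * log (Fintype.card (α × β × γ)) := by
  have : Fintype.card ((Fin n → α) × (Fin n → β) × (Fin n → γ)) =
      Fintype.card (α × β × γ) ^ n := by
    simp [mul_pow]
  rw [this, Nat.cast_pow, log_pow]

/-- Together the `N` unitaries remove at most `log N ≤ n R` bits of conditional mutual information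
from `ρ^{⊗ n}`, and the state they produce has almost none left. -/
theorem condMutualInfo_le_of_isMarkovianizedWith {ρ : QState (α × β × γ)} {R : ℝ}
    (h : IsMarkovianizedWith ρ R) : ρ.condMutualInfo ≤ R := by
  refine le_of_forall_mul_le_add (K := 4 / log 2) (L := log (Fintype.card (α × β × γ)))
    (by have := log_pos one_lt_two; positivity) (log_natCast_nonneg _) fun ε hε => ?_
  obtain ⟨n₀, hn₀⟩ := h ε hε
  refine ⟨n₀, fun n hn => ?_⟩
  obtain ⟨hN, V, Υ, hΥ, hV⟩ := hn₀ n hn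
  have hnear : (mix hN (fun k => extendUnitary _ (V k)) (ρ.copies n)).Near Υ ε :=
    near_of_traceNorm_le hV
  have h1 := hnear.condMutualInfo_le hε.le
  have h2 := condMutualInfo_sub_logb_le_mix (ρ.copies n) hN V
  have h3 := logb_floor_rpow_le hN
  rw [hΥ, card_copies] at h1
  rw [copies_condMutualInfo] at h2
  have h4 : 4 / log 2 * (ε * (n * log (Fintype.card (α × β × γ))) + 1 + ε * (1 + ε)) =
      4 * ((ε * (n * log (Fintype.card (α × β × γ))) + 1 + ε * (1 + ε)) / log 2) := by ring
  rw [h4]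
  linarith

/-- Decoupling `A` from `BC` also decouples it from `B`, which takes a randomness cost of at least
`I(A:B)`. -/
theorem IsDecoupledWith.mutualInfo_le {ρ : QState (α × β × γ)} {R : ℝ}
    (h : ρ.IsDecoupledWith R) : ρ.assoc.fst.mutualInfo ≤ R := by
  refine le_of_forall_mul_le_add (K := 4 / log 2) (L := log (Fintype.card (α × β × γ)))
    (by have := log_pos one_lt_two; positivity) (log_natCast_nonneg _) fun ε hε => ?_
  obtain ⟨n₀, hn₀⟩ := h ε hε
  refine ⟨n₀, fun n hn => ?_⟩
  obtain ⟨hN, V, τ, σ, hV⟩ := hn₀ n hn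
  have hnear : (mix hN (fun k => extendUnitary _ (V k)) (ρ.copies n)).Near (τ.prod σ) ε :=
    near_of_traceNorm_le hV
  have h1 := hnear.assoc.fst.mutualInfo_le hε.le
  rw [mix_extend_assoc_fst, prod_assoc_fst, mutualInfo_prod] at h1
  have h2 := mutualInfo_sub_logb_le_mix (ρ.copies n).assoc.fst hN V
  have h3 := logb_floor_rpow_le hN
  have hI : (ρ.copies n).assoc.fst.mutualInfo = n * ρ.assoc.fst.mutualInfo := by
    rw [mutualInfo, mutualInfo, assoc_fst_fst, assoc_fst_fst, assoc_fst_snd, assoc_fst_snd,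
      (ρ.copies_fst_isPow n).entropy_eq, (ρ.copies_snd_fst_isPow n).entropy_eq,
      (ρ.copies_assoc_fst_isPow n).entropy_eq]
    ring
  have := (ρ.copies n).assoc.fst.nonempty
  have := (ρ.copies n).assoc.snd.nonempty
  have hcard : log (Fintype.card ((Fin n → α) × (Fin n → β))) ≤
      n * log (Fintype.card (α × β × γ)) := by
    rw [← card_copies, ← Fintype.card_congr (Equiv.prodAssoc (Fin n → α) (Fin n → β) (Fin n → γ))]
    exact log_card_prod_left_le
  have h5 : (ε * log (Fintype.card ((Fin n → α) × (Fin n → β))) + 1 + ε * (1 + ε)) / log 2 ≤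
      (ε * (n * log (Fintype.card (α × β × γ))) + 1 + ε * (1 + ε)) / log 2 := by
    have := mul_le_mul_of_nonneg_left hcard hε.le
    exact div_le_div_of_nonneg_right (by linarith) (log_pos one_lt_two).le
  have h4 : 4 / log 2 * (ε * (n * log (Fintype.card (α × β × γ))) + 1 + ε * (1 + ε)) =
      4 * ((ε * (n * log (Fintype.card (α × β × γ))) + 1 + ε * (1 + ε)) / log 2) := by ring
  rw [h4]
  linarith

end Converse

end QState

/-! ### Second moments of independent sums and typical sequences -/

section Typical

variable {ι : Type*} [Fintype ι]

/-- The second moment of a sum of independent centred random vectors. -/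
theorem sum_prod_mul_norm_sum_sq {E : Type*} [NormedAddCommGroup E] [InnerProductSpace ℝ E]
    {p : ι → ℝ} (hp : ∑ i, p i = 1) {h : ι → E} (hh : ∑ i, p i • h i = 0) (n : ℕ) :
    ∑ x : Fin n → ι, (∏ i, p (x i)) * ‖∑ i, h (x i)‖ ^ 2 = n * ∑ i, p i * ‖h i‖ ^ 2 := by
  induction n with
  | zero => simp
  | succ n ih =>
    rw [sum_fin_succ_fun]
    simp only [Fin.prod_univ_succ, Fin.sum_univ_succ, Fin.cons_zero, Fin.cons_succ]
    have hexp : ∀ (a : ι) (y : Fin n → ι),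
        p a * (∏ i, p (y i)) * ‖h a + ∑ i, h (y i)‖ ^ 2 =
          (∏ i, p (y i)) * (p a * ‖h a‖ ^ 2) +
          2 * (∏ i, p (y i)) * inner ℝ (p a • h a) (∑ i, h (y i)) +
          p a * ((∏ i, p (y i)) * ‖∑ i, h (y i)‖ ^ 2) := fun a y => by
      rw [norm_add_sq_real, real_inner_smul_left]
      ring
    have hcross : ∑ a, ∑ y : Fin n → ι,
        2 * (∏ i, p (y i)) * inner ℝ (p a • h a) (∑ i, h (y i)) = 0 := by
      rw [Finset.sum_comm]
      refine Finset.sum_eq_zero fun y _ => ?_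
      rw [← Finset.mul_sum, ← sum_inner, hh, inner_zero_left, mul_zero]
    simp only [hexp, Finset.sum_add_distrib]
    rw [hcross]
    simp only [← Finset.mul_sum, ← Finset.sum_mul, ih, sum_prod_eq_one hp, hp]
    push_cast
    ring

/-- The variance of the surprisal `-log p`. -/
noncomputable def surprisalVariance (p : ι → ℝ) : ℝ :=
  ∑ i, p i * (-log (p i) - ∑ j, negMulLog (p j)) ^ 2

theorem surprisalVariance_nonneg {p : ι → ℝ} (hp0 : ∀ i, 0 ≤ p i) : 0 ≤ surprisalVariance p :=
  Finset.sum_nonneg fun i _ => mul_nonneg (hp0 i) (sq_nonneg _)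

/-- **Asymptotic equipartition**: by Chebyshev's inequality, the surprisal of a random sequence is
close to `n` times the entropy. -/
theorem sum_atypical_le {p : ι → ℝ} (hp0 : ∀ i, 0 ≤ p i) (hp : ∑ i, p i = 1) {n : ℕ}
    (hn : 0 < n) {δ : ℝ} (hδ : 0 < δ) (s : Finset (Fin n → ι))
    (hs : ∀ x ∈ s, ∏ i, p (x i) ≠ 0 →
      n * δ ≤ |-log (∏ i, p (x i)) - n * ∑ j, negMulLog (p j)|) :
    ∑ x ∈ s, ∏ i, p (x i) ≤ surprisalVariance p / δ ^ 2 / n := by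
  have hn' : (0 : ℝ) < n := by exact_mod_cast hn
  set S := ∑ j, negMulLog (p j) with hS
  have hq : ∀ x : Fin n → ι, 0 ≤ ∏ i, p (x i) := fun x => Finset.prod_nonneg fun i _ => hp0 _
  have hmean : ∑ i, p i • (-log (p i) - S) = 0 := by
    simp only [smul_eq_mul, mul_sub, Finset.sum_sub_distrib, ← Finset.sum_mul, hp, one_mul]
    rw [hS, sub_eq_zero]
    exact Finset.sum_congr rfl fun i _ => by rw [negMulLog]; ring
  have hmom := sum_prod_mul_norm_sum_sq hp hmean n
  have hpt : ∀ x ∈ s, (∏ i, p (x i)) * (n * δ) ^ 2 ≤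
      (∏ i, p (x i)) * ‖∑ i, (-log (p (x i)) - S)‖ ^ 2 := by
    intro x hx
    rcases eq_or_ne (∏ i, p (x i)) 0 with h0 | h0
    · simp [h0]
    · refine mul_le_mul_of_nonneg_left ?_ (hq x)
      have h1 := hs x hx h0
      have h2 : -log (∏ i, p (x i)) - n * S = ∑ i, (-log (p (x i)) - S) := by
        rw [log_prod (fun i _ => fun hi => h0 (Finset.prod_eq_zero (Finset.mem_univ i) hi)),
          Finset.sum_sub_distrib, Finset.sum_neg_distrib]
        simp
      rw [h2] at h1
      rw [Real.norm_eq_abs]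
      exact pow_le_pow_left₀ (by positivity) h1 2
  have h3 : (∑ x ∈ s, ∏ i, p (x i)) * (n * δ) ^ 2 ≤ n * surprisalVariance p := by
    rw [Finset.sum_mul]
    refine (Finset.sum_le_sum hpt).trans ((Finset.sum_le_univ_sum_of_nonneg fun x =>
      mul_nonneg (hq x) (sq_nonneg _)).trans_eq ?_)
    rw [hmom]
    simp [surprisalVariance, hS]
  rw [div_div, le_div_iff₀ (by positivity)]
  have h4 : (∑ x ∈ s, ∏ i, p (x i)) * (δ ^ 2 * n) * n ≤ surprisalVariance p * n := by
    calc _ = (∑ x ∈ s, ∏ i, p (x i)) * (n * δ) ^ 2 := by ring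
      _ ≤ _ := h3
      _ = _ := mul_comm _ _
  exact le_of_mul_le_mul_right h4 hn'

/-- Few sequences carry almost all of the probability. -/
theorem exists_likely_set [DecidableEq ι] {p : ι → ℝ} (hp0 : ∀ i, 0 ≤ p i)
    (hp : ∑ i, p i = 1) {n : ℕ} (hn : 0 < n) {δ : ℝ} (hδ : 0 < δ) : ∃ T : Finset (Fin n → ι),
      (T.card : ℝ) ≤ exp (n * (∑ j, negMulLog (p j) + δ)) ∧
      ∑ x ∈ Tᶜ, ∏ i, p (x i) ≤ surprisalVariance p / δ ^ 2 / n := by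
  set S := ∑ j, negMulLog (p j) with hS
  have hq : ∀ x : Fin n → ι, 0 ≤ ∏ i, p (x i) := fun x => Finset.prod_nonneg fun i _ => hp0 _
  refine ⟨Finset.univ.filter fun x => exp (-(n * (S + δ))) ≤ ∏ i, p (x i), ?_,
    sum_atypical_le hp0 hp hn hδ _ fun x hx h0 => ?_⟩
  · have h1 : ((Finset.univ.filter fun x : Fin n → ι =>
        exp (-(n * (S + δ))) ≤ ∏ i, p (x i)).card : ℝ) * exp (-(n * (S + δ))) ≤ 1 := by
      rw [← sum_prod_eq_one hp n, ← nsmul_eq_mul, ← Finset.sum_const]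
      refine (Finset.sum_le_sum fun x hx => (Finset.mem_filter.mp hx).2).trans ?_
      exact Finset.sum_le_univ_sum_of_nonneg hq
    rwa [← le_div_iff₀ (exp_pos _), one_div, ← Real.exp_neg, neg_neg] at h1
  · simp only [Finset.mem_compl, Finset.mem_filter, Finset.mem_univ, true_and, not_le] at hx
    have h1 := log_lt_log ((hq x).lt_of_ne' h0) hx
    rw [log_exp] at h1
    exact le_trans (by linarith) (le_abs_self _)

/-- Almost all of the probability is carried by sequences of small probability. -/
theorem exists_spread_set [DecidableEq ι] {p : ι → ℝ} (hp0 : ∀ i, 0 ≤ p i)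
    (hp : ∑ i, p i = 1) {n : ℕ} (hn : 0 < n) {δ : ℝ} (hδ : 0 < δ) : ∃ T : Finset (Fin n → ι),
      (∀ x ∈ T, ∏ i, p (x i) ≤ exp (-(n * (∑ j, negMulLog (p j) - δ)))) ∧
      ∑ x ∈ Tᶜ, ∏ i, p (x i) ≤ surprisalVariance p / δ ^ 2 / n := by
  set S := ∑ j, negMulLog (p j) with hS
  refine ⟨Finset.univ.filter fun x => ∏ i, p (x i) ≤ exp (-(n * (S - δ))),
    fun x hx => (Finset.mem_filter.mp hx).2, sum_atypical_le hp0 hp hn hδ _ fun x hx h0 => ?_⟩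
  simp only [Finset.mem_compl, Finset.mem_filter, Finset.mem_univ, true_and, not_le] at hx
  have h1 := log_lt_log (exp_pos _) hx
  rw [log_exp] at h1
  exact le_trans (by linarith) (neg_le_abs _)

end Typical

/-! ### The Hilbert–Schmidt norm -/

section HilbertSchmidt

/-- The squared Hilbert–Schmidt norm of a matrix. -/
noncomputable def hsNormSq {m n : Type*} [Fintype m] [Fintype n] (M : Matrix m n ℂ) : ℝ :=
  ∑ i, ∑ j, ‖M i j‖ ^ 2

theorem hsNormSq_nonneg {m n : Type*} [Fintype m] [Fintype n] (M : Matrix m n ℂ) :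
    0 ≤ hsNormSq M :=
  Finset.sum_nonneg fun _ _ => Finset.sum_nonneg fun _ _ => sq_nonneg _

theorem hsNormSq_eq_trace {m n : Type*} [Fintype m] [Fintype n] (M : Matrix m n ℂ) :
    ((hsNormSq M : ℝ) : ℂ) = (Mᴴ * M).trace := by
  simp only [hsNormSq, Matrix.trace, Matrix.diag, mul_apply, conjTranspose_apply, RCLike.star_def,
    Complex.conj_mul']
  push_cast
  exact Finset.sum_comm

theorem hsNormSq_conjTranspose {m n : Type*} [Fintype m] [Fintype n] (M : Matrix m n ℂ) :
    hsNormSq Mᴴ = hsNormSq M := by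
  simp only [hsNormSq, conjTranspose_apply, norm_star]
  exact Finset.sum_comm

variable {ι : Type*} [Fintype ι] [DecidableEq ι]

theorem hsNormSq_unitary_mul (U : unitaryGroup ι ℂ) (M : Matrix ι ι ℂ) :
    hsNormSq ((U : Matrix ι ι ℂ) * M) = hsNormSq M := by
  have h : ((hsNormSq ((U : Matrix ι ι ℂ) * M) : ℝ) : ℂ) = ((hsNormSq M : ℝ) : ℂ) := by
    rw [hsNormSq_eq_trace, hsNormSq_eq_trace, conjTranspose_mul, Matrix.mul_assoc,
      ← Matrix.mul_assoc _ (U : Matrix ι ι ℂ), unitary_conjTranspose_mul_self, Matrix.one_mul]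
  exact_mod_cast h

theorem hsNormSq_unitary_conj (U : unitaryGroup ι ℂ) (M : Matrix ι ι ℂ) :
    hsNormSq ((U : Matrix ι ι ℂ) * M * (U : Matrix ι ι ℂ)ᴴ) = hsNormSq M := by
  rw [Matrix.mul_assoc, hsNormSq_unitary_mul, ← hsNormSq_conjTranspose, conjTranspose_mul,
    conjTranspose_conjTranspose, hsNormSq_unitary_mul, hsNormSq_conjTranspose]

theorem norm_trace_mul_le {ι : Type*} [Fintype ι] (A B : Matrix ι ι ℂ) :
    ‖(A * B).trace‖ ≤ √(hsNormSq A) * √(hsNormSq B) := by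
  have h1 : (A * B).trace = ∑ x : ι × ι, A x.1 x.2 * B x.2 x.1 := by
    rw [Fintype.sum_prod_type]
    rfl
  have hA : hsNormSq A = ∑ x : ι × ι, ‖A x.1 x.2‖ ^ 2 := by
    rw [Fintype.sum_prod_type]
    rfl
  have hB : hsNormSq B = ∑ x : ι × ι, ‖B x.2 x.1‖ ^ 2 := by
    rw [Fintype.sum_prod_type_right]
    rfl
  rw [h1, hA, hB]
  refine (norm_sum_le _ _).trans ?_
  simp only [norm_mul]
  exact Real.sum_mul_le_sqrt_mul_sqrt _ _ _

/-- The projection onto the span of the basis vectors indexed by `s`. -/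
def coordProj {ι : Type*} [DecidableEq ι] (s : Finset ι) : Matrix ι ι ℂ :=
  diagonal fun i => if i ∈ s then 1 else 0

theorem coordProj_mul_apply (s : Finset ι) (M : Matrix ι ι ℂ) (i j : ι) :
    (coordProj s * M) i j = if i ∈ s then M i j else 0 := by
  simp [coordProj, diagonal_mul]

theorem coordProj_conjTranspose {ι : Type*} [DecidableEq ι] (s : Finset ι) :
    (coordProj s)ᴴ = coordProj s := by
  rw [coordProj, diagonal_conjTranspose]
  congr 1
  ext i
  by_cases h : i ∈ s <;> simp [h]

theorem one_sub_coordProj (s : Finset ι) : 1 - coordProj s = coordProj sᶜ := by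
  rw [coordProj, coordProj, ← diagonal_one, diagonal_sub]
  congr 1
  ext i
  by_cases h : i ∈ s <;> simp [h]

theorem hsNormSq_coordProj (s : Finset ι) : hsNormSq (coordProj s) = s.card := by
  have h : ∀ i j, ‖coordProj s i j‖ ^ 2 = if i = j then (if i ∈ s then (1 : ℝ) else 0) else 0 := by
    intro i j
    by_cases hij : i = j
    · subst hij
      by_cases hi : i ∈ s <;> simp [coordProj, hi]
    · simp [coordProj, hij]
  simp [hsNormSq, h]

theorem hsNormSq_coordProj_mul (s : Finset ι) (M : Matrix ι ι ℂ) :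
    hsNormSq (coordProj s * M) = ∑ i ∈ s, ∑ j, ‖M i j‖ ^ 2 := by
  simp only [hsNormSq, coordProj_mul_apply]
  rw [← Finset.sum_filter_add_sum_filter_not Finset.univ (· ∈ s)]
  rw [Finset.sum_eq_zero (s := Finset.univ.filter fun i => ¬ i ∈ s), add_zero,
    Finset.filter_univ_mem]
  · refine Finset.sum_congr rfl fun i hi => ?_
    simp [hi]
  · intro i hi
    simp [(Finset.mem_filter.mp hi).2]

theorem hsNormSq_coordProj_mul_le (s : Finset ι) (M : Matrix ι ι ℂ) :
    hsNormSq (coordProj s * M) ≤ hsNormSq M := by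
  rw [hsNormSq_coordProj_mul]
  exact Finset.sum_le_univ_sum_of_nonneg fun _ => Finset.sum_nonneg fun _ _ => sq_nonneg _

theorem hsNormSq_coordProj_conj_le (s : Finset ι) (M : Matrix ι ι ℂ) :
    hsNormSq (coordProj s * M * coordProj s) ≤ hsNormSq M := by
  rw [← hsNormSq_conjTranspose, conjTranspose_mul, coordProj_conjTranspose]
  refine (hsNormSq_coordProj_mul_le _ _).trans ?_
  rw [hsNormSq_conjTranspose]
  exact hsNormSq_coordProj_mul_le _ _

theorem Matrix.PosSemidef.exists_eq_conjTranspose_mul_self {M : Matrix ι ι ℂ}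
    (hM : M.PosSemidef) : ∃ Z : Matrix ι ι ℂ, M = Zᴴ * Z := by
  obtain ⟨U, d, hd, h⟩ := hM.exists_unitary_diagonal
  refine ⟨diagonal (fun i => ((√(d i) : ℝ) : ℂ)) * (U : Matrix ι ι ℂ)ᴴ, ?_⟩
  have hsq : diagonal (fun i => (d i : ℂ)) =
      diagonal (fun i => ((√(d i) : ℝ) : ℂ)) * diagonal (fun i => ((√(d i) : ℝ) : ℂ)) := by
    rw [diagonal_mul_diagonal]
    congr 1
    ext i
    rw [← Complex.ofReal_mul, Real.mul_self_sqrt (hd i)]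
  have hself : (diagonal (fun i => ((√(d i) : ℝ) : ℂ)))ᴴ =
      diagonal (fun i => ((√(d i) : ℝ) : ℂ)) := by
    rw [diagonal_conjTranspose]
    congr 1
    ext i
    simp
  rw [h, conjTranspose_mul, conjTranspose_conjTranspose, hself, hsq]
  simp only [Matrix.mul_assoc]

theorem Matrix.PosSemidef.traceNormLE {M : Matrix ι ι ℂ} (hM : M.PosSemidef) :
    TraceNormLE M M.trace.re := fun U => by
  obtain ⟨Z, rfl⟩ := hM.exists_eq_conjTranspose_mul_self
  rw [← Matrix.mul_assoc, ← hsNormSq_eq_trace, Complex.ofReal_re]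
  refine (norm_trace_mul_le _ _).trans_eq ?_
  rw [hsNormSq_unitary_mul, hsNormSq_conjTranspose, Real.mul_self_sqrt (hsNormSq_nonneg Z)]

/-- A matrix with few nonzero rows has its trace norm controlled by its Hilbert–Schmidt norm. -/
theorem traceNormLE_of_rows {H : Matrix ι ι ℂ} {s : Finset ι} (hs : ∀ i ∉ s, ∀ j, H i j = 0) :
    TraceNormLE H (√(s.card * hsNormSq H)) := fun U => by
  have hH : coordProj s * H = H := by
    ext i j
    rw [coordProj_mul_apply]
    split_ifs with h
    · rfl
    · exact (hs i h j).symm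
  rw [← hH, ← Matrix.mul_assoc, hH]
  refine (norm_trace_mul_le _ _).trans_eq ?_
  rw [hsNormSq_unitary_mul, hsNormSq_coordProj, Real.sqrt_mul (Nat.cast_nonneg _)]

/-- **Gentle measurement**: a projection of high probability hardly disturbs the state. -/
theorem Matrix.PosSemidef.traceNormLE_sub_coordProj {M : Matrix ι ι ℂ} (hM : M.PosSemidef)
    (hM1 : M.trace.re ≤ 1) (s : Finset ι) :
    TraceNormLE (M - coordProj s * M * coordProj s) (2 * √(∑ i ∈ sᶜ, (M i i).re)) := fun U => by
  obtain ⟨Z, rfl⟩ := hM.exists_eq_conjTranspose_mul_self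
  have hdecomp : Zᴴ * Z - coordProj s * (Zᴴ * Z) * coordProj s =
      coordProj sᶜ * Zᴴ * Z + coordProj s * Zᴴ * (Z * coordProj sᶜ) := by
    rw [← one_sub_coordProj]
    noncomm_ring
  have h1 : hsNormSq (coordProj sᶜ * Zᴴ) = ∑ i ∈ sᶜ, ((Zᴴ * Z) i i).re := by
    rw [hsNormSq_coordProj_mul]
    refine Finset.sum_congr rfl fun i _ => ?_
    rw [mul_apply, Complex.re_sum]
    refine Finset.sum_congr rfl fun j _ => ?_
    rw [conjTranspose_apply, norm_star, RCLike.star_def, Complex.conj_mul']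
    norm_cast
  have h2 : hsNormSq (Z * coordProj sᶜ) = ∑ i ∈ sᶜ, ((Zᴴ * Z) i i).re := by
    rw [← h1, ← hsNormSq_conjTranspose, conjTranspose_mul, coordProj_conjTranspose]
  have hZ : hsNormSq Z ≤ 1 := by
    rwa [← hsNormSq_eq_trace, Complex.ofReal_re] at hM1
  have h3 : hsNormSq (coordProj s * Zᴴ) ≤ 1 :=
    (hsNormSq_coordProj_mul_le _ _).trans ((hsNormSq_conjTranspose Z).trans_le hZ)
  rw [hdecomp, Matrix.mul_add, trace_add, ← Matrix.mul_assoc, ← Matrix.mul_assoc]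
  refine (norm_add_le _ _).trans ?_
  have h4 := norm_trace_mul_le ((U : Matrix ι ι ℂ) * (coordProj sᶜ * Zᴴ)) Z
  have h5 := norm_trace_mul_le ((U : Matrix ι ι ℂ) * (coordProj s * Zᴴ)) (Z * coordProj sᶜ)
  rw [hsNormSq_unitary_mul, h1] at h4
  rw [hsNormSq_unitary_mul, h2] at h5
  have h6 := mul_le_mul_of_nonneg_left (Real.sqrt_le_one.mpr hZ)
    (Real.sqrt_nonneg (∑ i ∈ sᶜ, ((Zᴴ * Z) i i).re))
  have h7 := mul_le_mul_of_nonneg_right (Real.sqrt_le_one.mpr h3)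
    (Real.sqrt_nonneg (∑ i ∈ sᶜ, ((Zᴴ * Z) i i).re))
  rw [mul_one] at h6
  rw [one_mul] at h7
  rw [two_mul]
  simp only [Matrix.mul_assoc] at h4 h5 ⊢
  exact add_le_add (h4.trans h6) (h5.trans h7)

end HilbertSchmidt

/-! ### Random signed permutations -/

section RandomUnitaries

variable {ι : Type*} [Fintype ι] [DecidableEq ι]

/-- The average of the conjugates of `M` by a finite family of unitaries. -/
noncomputable def twirl {G : Type*} [Fintype G] (V : G → unitaryGroup ι ℂ) (M : Matrix ι ι ℂ) :
    Matrix ι ι ℂ :=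
  (Fintype.card G : ℂ)⁻¹ • ∑ g, (V g : Matrix ι ι ℂ) * M * (V g : Matrix ι ι ℂ)ᴴ

/-- The variance is at most the second moment. -/
theorem sum_norm_sub_mean_sq_le {G : Type*} [Fintype G] [Nonempty G] (f : G → ℂ) :
    ∑ g, ‖f g - (Fintype.card G : ℂ)⁻¹ * ∑ g', f g'‖ ^ 2 ≤ ∑ g, ‖f g‖ ^ 2 := by
  set m := (Fintype.card G : ℂ)⁻¹ * ∑ g', f g' with hm
  have hc : (Fintype.card G : ℂ) ≠ 0 := by exact_mod_cast Fintype.card_ne_zero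
  have hsum : ∑ g, f g = Fintype.card G * m := by rw [hm, mul_inv_cancel_left₀ hc]
  have h : ∀ g, ‖f g - m‖ ^ 2 = ‖f g‖ ^ 2 - 2 * inner ℝ (f g) m + ‖m‖ ^ 2 := fun g =>
    norm_sub_sq_real _ _
  have h2 : inner ℝ ((Fintype.card G : ℂ) * m) m = (Fintype.card G : ℝ) * ‖m‖ ^ 2 := by
    rw [← real_inner_self_eq_norm_sq, ← real_inner_smul_left, Complex.real_smul,
      Complex.ofReal_natCast]
  simp only [h, Finset.sum_add_distrib, Finset.sum_sub_distrib, ← Finset.mul_sum, ← sum_inner,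
    hsum, h2, Finset.sum_const, Finset.card_univ, nsmul_eq_mul]
  have : 0 ≤ (Fintype.card G : ℝ) * ‖m‖ ^ 2 := by positivity
  linarith

/-- Among `N` unitaries drawn independently from a finite family, some choice approximates the
average over the whole family with a squared Hilbert–Schmidt error of order `1 / N`. -/
theorem exists_unitaryAverage_near_twirl {G : Type*} [Fintype G] [Nonempty G]
    (V : G → unitaryGroup ι ℂ) (M : Matrix ι ι ℂ) {N : ℕ} (hN : 0 < N) :
    ∃ k : Fin N → G,
      hsNormSq (unitaryAverage (fun i => V (k i)) M - twirl V M) ≤ hsNormSq M / N := by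
  have hN' : (0 : ℝ) < N := by exact_mod_cast hN
  have hNc : (N : ℂ) ≠ 0 := by exact_mod_cast hN.ne'
  have hc : (0 : ℝ) < Fintype.card G := by exact_mod_cast Fintype.card_pos
  have hcc : (Fintype.card G : ℂ) ≠ 0 := by exact_mod_cast Fintype.card_ne_zero
  let p : G → ℝ := fun _ => (Fintype.card G : ℝ)⁻¹
  have hp : ∑ g, p g = 1 := by simp [p]
  let Y : G → Matrix ι ι ℂ := fun g => (V g : Matrix ι ι ℂ) * M * (V g : Matrix ι ι ℂ)ᴴ
  have hT : ∀ i j, twirl V M i j = (Fintype.card G : ℂ)⁻¹ * ∑ g, Y g i j := fun i j => by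
    simp [twirl, Y, Matrix.sum_apply]
  have hmean : ∀ i j, ∑ g, p g • (Y g i j - twirl V M i j) = 0 := fun i j => by
    rw [← Finset.smul_sum, Finset.sum_sub_distrib, hT, Finset.sum_const, Finset.card_univ,
      nsmul_eq_mul, mul_inv_cancel_left₀ hcc, sub_self, smul_zero]
  have hY : ∀ g, hsNormSq (Y g) = hsNormSq M := fun g => hsNormSq_unitary_conj _ _
  have hvar : ∑ g, ∑ i, ∑ j, p g * ‖Y g i j - twirl V M i j‖ ^ 2 ≤ hsNormSq M := by
    calc ∑ g, ∑ i, ∑ j, p g * ‖Y g i j - twirl V M i j‖ ^ 2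
        = ∑ i, ∑ j, (Fintype.card G : ℝ)⁻¹ * ∑ g, ‖Y g i j - twirl V M i j‖ ^ 2 := by
          rw [Finset.sum_comm]
          refine Finset.sum_congr rfl fun i _ => ?_
          rw [Finset.sum_comm]
          simp only [p, Finset.mul_sum]
      _ ≤ ∑ i, ∑ j, (Fintype.card G : ℝ)⁻¹ * ∑ g, ‖Y g i j‖ ^ 2 := by
          refine Finset.sum_le_sum fun i _ => Finset.sum_le_sum fun j _ =>
            mul_le_mul_of_nonneg_left ?_ (by positivity)
          rw [hT]
          exact sum_norm_sub_mean_sq_le fun g => Y g i j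
      _ = (Fintype.card G : ℝ)⁻¹ * ∑ g, hsNormSq (Y g) := by
          simp only [hsNormSq, ← Finset.mul_sum]
          congr 1
          symm
          rw [Finset.sum_comm]
          refine Finset.sum_congr rfl fun i _ => ?_
          rw [Finset.sum_comm]
      _ = hsNormSq M := by
          simp only [hY, Finset.sum_const, Finset.card_univ, nsmul_eq_mul]
          rw [inv_mul_cancel_left₀ hc.ne']
  have hmom : ∑ k : Fin N → G, (∏ l, p (k l)) *
      ∑ i, ∑ j, ‖∑ l, (Y (k l) i j - twirl V M i j)‖ ^ 2 ≤
      ∑ k : Fin N → G, (∏ l, p (k l)) * (N * hsNormSq M) := by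
    rw [← Finset.sum_mul, sum_prod_eq_one hp, one_mul]
    calc ∑ k : Fin N → G, (∏ l, p (k l)) *
          ∑ i, ∑ j, ‖∑ l, (Y (k l) i j - twirl V M i j)‖ ^ 2
        = ∑ i, ∑ j, ∑ k : Fin N → G, (∏ l, p (k l)) *
          ‖∑ l, (Y (k l) i j - twirl V M i j)‖ ^ 2 := by
          simp only [Finset.mul_sum]
          rw [Finset.sum_comm]
          refine Finset.sum_congr rfl fun i _ => ?_
          rw [Finset.sum_comm]
      _ = ∑ i, ∑ j, N * ∑ g, p g * ‖Y g i j - twirl V M i j‖ ^ 2 :=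
          Finset.sum_congr rfl fun i _ => Finset.sum_congr rfl fun j _ =>
            sum_prod_mul_norm_sum_sq hp (hmean i j) N
      _ = N * ∑ g, ∑ i, ∑ j, p g * ‖Y g i j - twirl V M i j‖ ^ 2 := by
          symm
          rw [Finset.sum_comm, Finset.mul_sum]
          refine Finset.sum_congr rfl fun i _ => ?_
          rw [Finset.sum_comm, Finset.mul_sum]
      _ ≤ N * hsNormSq M := mul_le_mul_of_nonneg_left hvar hN'.le
  obtain ⟨k, -, hk⟩ := Finset.exists_le_of_sum_le
    (Finset.univ_nonempty (α := Fin N → G)) hmom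
  have hpk : 0 < ∏ l, p (k l) := Finset.prod_pos fun l _ => by positivity
  have hk' := le_of_mul_le_mul_left hk hpk
  refine ⟨k, ?_⟩
  have hentry : ∀ i j, ‖(unitaryAverage (fun i => V (k i)) M - twirl V M) i j‖ ^ 2 =
      ((N : ℝ) ^ 2)⁻¹ * ‖∑ l, (Y (k l) i j - twirl V M i j)‖ ^ 2 := fun i j => by
    have : (unitaryAverage (fun i => V (k i)) M - twirl V M) i j =
        (N : ℂ)⁻¹ * ∑ l, (Y (k l) i j - twirl V M i j) := by
      rw [Finset.sum_sub_distrib, mul_sub, Finset.sum_const, Finset.card_univ, Fintype.card_fin,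
        nsmul_eq_mul, inv_mul_cancel_left₀ hNc]
      simp [unitaryAverage, Y, Matrix.sum_apply]
    rw [this, norm_mul, mul_pow, norm_inv, Complex.norm_natCast, inv_pow]
  rw [hsNormSq]
  simp only [hentry, ← Finset.mul_sum]
  rw [inv_mul_le_iff₀ (by positivity)]
  refine hk'.trans_eq ?_
  field_simp

/-- The signed permutation matrix with the entry `s a` at `(a, σ a)`. -/
def signedPerm (σ : Equiv.Perm ι) (s : ι → ℤˣ) : Matrix ι ι ℂ :=
  Matrix.of fun a x => if σ a = x then (((s a : ℤˣ) : ℤ) : ℂ) else 0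

theorem intUnits_mul_self_cast (u : ℤˣ) : (((u : ℤˣ) : ℤ) : ℂ) * (((u : ℤˣ) : ℤ) : ℂ) = 1 := by
  rcases Int.units_eq_one_or u with rfl | rfl <;> simp

theorem signedPerm_mem_unitaryGroup (σ : Equiv.Perm ι) (s : ι → ℤˣ) :
    signedPerm σ s ∈ unitaryGroup ι ℂ := by
  rw [mem_unitaryGroup_iff, star_eq_conjTranspose]
  ext a b
  rw [mul_apply, Finset.sum_eq_single (σ a)]
  · by_cases h : a = b
    · subst h
      simp [signedPerm, conjTranspose_apply, intUnits_mul_self_cast]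
    · have h' : σ b ≠ σ a := fun hab => h (σ.injective hab).symm
      simp [signedPerm, conjTranspose_apply, h, h']
  · intro x _ hx
    simp [signedPerm, hx.symm]
  · simp

/-- The independent random signs kill the entries off the diagonal. -/
theorem sum_signs_mul (a b : ι) :
    ∑ s : ι → ℤˣ, (((s a : ℤˣ) : ℤ) : ℂ) * (((s b : ℤˣ) : ℤ) : ℂ) =
      if a = b then (Fintype.card (ι → ℤˣ) : ℂ) else 0 := by
  by_cases h : a = b
  · subst h
    simp only [intUnits_mul_self_cast, Finset.sum_const, Finset.card_univ, nsmul_eq_mul, mul_one,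
      if_true]
  · rw [if_neg h]
    have h1 := Equiv.sum_comp (Equiv.mulLeft (Pi.mulSingle a (-1) : ι → ℤˣ))
      fun s : ι → ℤˣ => (((s a : ℤˣ) : ℤ) : ℂ) * (((s b : ℤˣ) : ℤ) : ℂ)
    have h2 : ∀ s : ι → ℤˣ,
        ((((Equiv.mulLeft (Pi.mulSingle a (-1) : ι → ℤˣ)) s a : ℤˣ) : ℤ) : ℂ) *
        ((((Equiv.mulLeft (Pi.mulSingle a (-1) : ι → ℤˣ)) s b : ℤˣ) : ℤ) : ℂ) =
        -((((s a : ℤˣ) : ℤ) : ℂ) * (((s b : ℤˣ) : ℤ) : ℂ)) := fun s => by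
      simp [Pi.mulSingle_eq_of_ne (Ne.symm h)]
    simp only [h2, Finset.sum_neg_distrib] at h1
    exact self_eq_neg.mp h1.symm

/-- The random permutations flatten the diagonal. -/
theorem card_mul_sum_perm (f : ι → ℂ) (x : ι) :
    (Fintype.card ι : ℂ) * ∑ σ : Equiv.Perm ι, f (σ x) =
      Fintype.card (Equiv.Perm ι) * ∑ t, f t := by
  have h1 : ∀ y, ∑ σ : Equiv.Perm ι, f (σ y) = ∑ σ : Equiv.Perm ι, f (σ x) := fun y => by
    rw [← Equiv.sum_comp (Equiv.mulRight (Equiv.swap x y))]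
    simp
  have h2 : ∑ y, ∑ σ : Equiv.Perm ι, f (σ y) = Fintype.card (Equiv.Perm ι) * ∑ t, f t := by
    rw [Finset.sum_comm]
    simp [Equiv.sum_comp]
  rw [← h2]
  simp [h1]

end RandomUnitaries

/-! ### One-shot decoupling -/

section OneShot

variable {α β : Type*} [Fintype α] [DecidableEq α] [Fintype β] [DecidableEq β]

/-- The signed permutations of `α` that permute `T` and fix the points outside of it. -/
def signedPermOn (T : Finset α) (g : Equiv.Perm {x // x ∈ T} × (α → ℤˣ)) : unitaryGroup α ℂ :=
  ⟨signedPerm (Equiv.Perm.ofSubtype g.1) g.2, signedPerm_mem_unitaryGroup _ _⟩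

theorem conj_signedPerm_apply (σ : Equiv.Perm α) (s : α → ℤˣ) (M : Matrix (α × β) (α × β) ℂ)
    (i j : α × β) :
    ((signedPerm σ s ⊗ₖ (1 : Matrix β β ℂ)) * M * (signedPerm σ s ⊗ₖ (1 : Matrix β β ℂ))ᴴ) i j =
      M (σ i.1, i.2) (σ j.1, j.2) * ((((s i.1 : ℤˣ) : ℤ) : ℂ) * (((s j.1 : ℤˣ) : ℤ) : ℂ)) := by
  rw [conj_extend_apply, Finset.sum_eq_single (σ j.1), Finset.sum_eq_single (σ i.1)]
  · simp only [signedPerm, Matrix.of_apply, if_true, star_intCast]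
    ring
  · intro x _ hx
    simp [signedPerm, hx.symm]
  · simp
  · intro y _ hy
    simp [signedPerm, hy.symm]
  · simp

theorem ofSubtype_apply_mem_iff {α : Type*} [DecidableEq α] {T : Finset α}
    (σ : Equiv.Perm {x // x ∈ T}) (a : α) :
    Equiv.Perm.ofSubtype σ a ∈ T ↔ a ∈ T := by
  by_cases h : a ∈ T
  · rw [Equiv.Perm.ofSubtype_apply_of_mem σ h]
    simp [h]
  · rw [Equiv.Perm.ofSubtype_apply_of_not_mem σ h]

theorem conj_signedPermOn_apply_eq_zero {T : Finset α} {T' : Finset β}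
    {M : Matrix (α × β) (α × β) ℂ} (hM : ∀ i ∉ T ×ˢ T', ∀ j, M i j = 0)
    (g : Equiv.Perm {x // x ∈ T} × (α → ℤˣ)) {i : α × β} (hi : i ∉ T ×ˢ T') (j : α × β) :
    ((extendUnitary β (signedPermOn T g) : Matrix (α × β) (α × β) ℂ) * M *
      (extendUnitary β (signedPermOn T g) : Matrix (α × β) (α × β) ℂ)ᴴ) i j = 0 := by
  refine (conj_signedPerm_apply _ _ M i j).trans ?_
  rw [hM _ (fun h => hi ?_), zero_mul]
  rw [Finset.mem_product] at h ⊢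
  exact ⟨(ofSubtype_apply_mem_iff g.1 i.1).mp h.1, h.2⟩

/-- On a matrix supported by the coordinates in `T`, the signed permutations of `T` average to the
map that replaces the first factor by the maximally mixed state of `T`. -/
theorem twirl_signedPermOn {T : Finset α} (hT : T.Nonempty) {M : Matrix (α × β) (α × β) ℂ}
    (hM : ∀ i : α × β, i.1 ∉ T → ∀ j, M i j = 0) :
    twirl (fun g => extendUnitary β (signedPermOn T g)) M =
      ((T.card : ℂ)⁻¹ • coordProj T) ⊗ₖ ptraceLeft M := by
  have hTc : (T.card : ℂ) ≠ 0 := by exact_mod_cast hT.card_pos.ne'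
  have hP : (Fintype.card (Equiv.Perm {x // x ∈ T}) : ℂ) ≠ 0 := by
    exact_mod_cast Fintype.card_ne_zero
  have hS : (Fintype.card (α → ℤˣ) : ℂ) ≠ 0 := by exact_mod_cast Fintype.card_ne_zero
  have hMapply : ∀ (g : Equiv.Perm {x // x ∈ T} × (α → ℤˣ)) (i j : α × β),
      ((extendUnitary β (signedPermOn T g) : Matrix (α × β) (α × β) ℂ) * M *
      (extendUnitary β (signedPermOn T g) : Matrix (α × β) (α × β) ℂ)ᴴ) i j =
      M (Equiv.Perm.ofSubtype g.1 i.1, i.2) (Equiv.Perm.ofSubtype g.1 j.1, j.2) *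
        ((((g.2 i.1 : ℤˣ) : ℤ) : ℂ) * (((g.2 j.1 : ℤˣ) : ℤ) : ℂ)) := fun g i j =>
    conj_signedPerm_apply _ _ M i j
  ext ⟨a, b⟩ ⟨a', b'⟩
  simp only [twirl, Matrix.smul_apply, Matrix.sum_apply, hMapply, Fintype.sum_prod_type,
    ← Finset.mul_sum, sum_signs_mul, kroneckerMap_apply, coordProj, diagonal_apply, smul_eq_mul]
  by_cases haa : a = a'
  · subst haa
    by_cases ha : a ∈ T
    · have h1 := card_mul_sum_perm (fun t : {x // x ∈ T} => M (t, b) (t, b')) ⟨a, ha⟩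
      have h2 : ∑ t : {x // x ∈ T}, M (t, b) (t, b') = ptraceLeft M b b' := by
        rw [Finset.sum_coe_sort T (fun t => M (t, b) (t, b'))]
        exact Finset.sum_subset (Finset.subset_univ _) fun t _ ht => hM _ ht _
      have h3 : ∀ σ : Equiv.Perm {x // x ∈ T}, Equiv.Perm.ofSubtype σ a = σ ⟨a, ha⟩ := fun σ =>
        Equiv.Perm.ofSubtype_apply_of_mem σ ha
      rw [h2, Fintype.card_coe] at h1
      simp only [h3, if_true, ha, ← Finset.sum_mul, Fintype.card_prod, Nat.cast_mul]
      rw [mul_one, eq_inv_mul_iff_mul_eq₀ hTc]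
      rw [mul_left_comm, ← mul_assoc (T.card : ℂ), h1]
      field_simp
    · have h3 : ∀ σ : Equiv.Perm {x // x ∈ T}, Equiv.Perm.ofSubtype σ a = a := fun σ =>
        Equiv.Perm.ofSubtype_apply_of_not_mem σ ha
      simp [h3, hM (a, b) ha, ha]
  · simp [haa]

theorem TraceNormLE.smul {ι : Type*} [Fintype ι] [DecidableEq ι] {H : Matrix ι ι ℂ} {b : ℝ}
    (h : TraceNormLE H b) (c : ℂ) : TraceNormLE (c • H) (‖c‖ * b) := fun U => by
  rw [Matrix.mul_smul, trace_smul, norm_smul]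
  exact mul_le_mul_of_nonneg_left (h U) (norm_nonneg _)

theorem trace_twirl {ι G : Type*} [Fintype ι] [DecidableEq ι] [Fintype G] [Nonempty G]
    (V : G → unitaryGroup ι ℂ) (M : Matrix ι ι ℂ) : (twirl V M).trace = M.trace := by
  have hcc : (Fintype.card G : ℂ) ≠ 0 := by exact_mod_cast Fintype.card_ne_zero
  rw [twirl, trace_smul, trace_sum]
  simp [trace_unitary_conj, hcc]

theorem Matrix.PosSemidef.twirl {ι G : Type*} [Fintype ι] [DecidableEq ι] [Fintype G]
    (V : G → unitaryGroup ι ℂ) {M : Matrix ι ι ℂ} (hM : M.PosSemidef) :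
    (twirl V M).PosSemidef := by
  refine PosSemidef.smul (posSemidef_sum _ fun g _ => hM.mul_mul_conjTranspose_same _) ?_
  simp

/-- A union bound for the complement of a rectangle. -/
theorem sum_compl_product_le {f : α × β → ℝ} (hf : ∀ x, 0 ≤ f x) (T : Finset α) (T' : Finset β) :
    ∑ x ∈ (T ×ˢ T')ᶜ, f x ≤ ∑ a ∈ Tᶜ, ∑ b, f (a, b) + ∑ b ∈ T'ᶜ, ∑ a, f (a, b) := by
  have h : (T ×ˢ T')ᶜ ⊆ (Tᶜ ×ˢ Finset.univ) ∪ (Finset.univ ×ˢ T'ᶜ) := by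
    intro x hx
    simp only [Finset.mem_compl, Finset.mem_product, Finset.mem_union, Finset.mem_univ, and_true,
      true_and] at hx ⊢
    tauto
  refine (Finset.sum_le_sum_of_subset_of_nonneg h fun x _ _ => hf x).trans ?_
  have h2 := Finset.sum_union_inter (s₁ := Tᶜ ×ˢ Finset.univ) (s₂ := Finset.univ ×ˢ T'ᶜ) (f := f)
  have h3 : 0 ≤ ∑ x ∈ (Tᶜ ×ˢ Finset.univ) ∩ (Finset.univ ×ˢ T'ᶜ), f x :=
    Finset.sum_nonneg fun x _ => hf x
  rw [Finset.sum_product, Finset.sum_product_right] at h2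
  linarith

/-- Decoupling in a frame where the likely subspaces of both factors are spanned by basis vectors.
Restrict the state to these subspaces and to an approximation `Y` of small Hilbert–Schmidt norm,
which changes it little, and then average over random signed permutations of `T`. The hypothesis
`hη1` keeps the restricted state from vanishing. -/
theorem exists_decoupling_coordProj (ρ : QState (α × β)) (T : Finset α) (T' : Finset β)
    {Y : Matrix (α × β) (α × β) ℂ} (hY : Y.PosSemidef) (hYρ : (ρ.mat - Y).PosSemidef)
    {η h : ℝ} (hη : (ρ.mat - Y).trace.re ≤ η)
    (hT : ∑ a ∈ Tᶜ, (ρ.fst.mat a a).re ≤ η) (hT' : ∑ b ∈ T'ᶜ, (ρ.snd.mat b b).re ≤ η)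
    (hYh : hsNormSq Y ≤ h) {N : ℕ} (hN : 0 < N) (hη1 : η + 2 * √(2 * η) < 1) :
    ∃ (V : Fin N → unitaryGroup α ℂ) (τ : QState α) (σ : QState β),
      TraceNormLE (randomUnitary V ρ.mat - (τ.prod σ).mat)
        (2 * (η + 2 * √(2 * η)) + √(T.card * T'.card * (h / N))) := by
  set b := η + 2 * √(2 * η) with hb
  set P := coordProj (T ×ˢ T') with hP
  set X := P * Y * P with hX
  have hXpsd : X.PosSemidef := by
    have := hY.mul_mul_conjTranspose_same P
    rwa [hP, coordProj_conjTranspose] at this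
  have hXrow : ∀ i ∉ T ×ˢ T', ∀ j, X i j = 0 := fun i hi j => by
    rw [hX, hP, Matrix.mul_assoc, coordProj_mul_apply, if_neg hi]
  have hdiag : ∀ i, 0 ≤ (Y i i).re := fun i => (Complex.le_def.mp hY.diag_nonneg).1
  have hdiagle : ∀ i, (Y i i).re ≤ (ρ.mat i i).re := fun i => by
    have := (Complex.le_def.mp (hYρ.diag_nonneg (i := i))).1
    simpa using this
  have hρdiag : ∀ i, 0 ≤ (ρ.mat i i).re := fun i => (hdiag i).trans (hdiagle i)
  have hYtr : Y.trace.re ≤ 1 := by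
    have h1 := (Complex.le_def.mp hYρ.trace_nonneg).1
    rw [trace_sub, ρ.trace_eq_one] at h1
    simpa using h1
  have htail : ∑ i ∈ (T ×ˢ T')ᶜ, (Y i i).re ≤ 2 * η := by
    refine (Finset.sum_le_sum fun i _ => hdiagle i).trans ?_
    refine (sum_compl_product_le hρdiag T T').trans ?_
    have h1 : ∀ a, ∑ y, (ρ.mat (a, y) (a, y)).re = (ρ.fst.mat a a).re := fun a => by
      simp [QState.fst, ptraceRight]
    have h2 : ∀ y, ∑ a, (ρ.mat (a, y) (a, y)).re = (ρ.snd.mat y y).re := fun y => by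
      simp [QState.snd, ptraceLeft]
    simp only [h1, h2]
    linarith
  -- The restriction costs little in trace norm.
  have hcut : TraceNormLE (ρ.mat - X) b := by
    have h1 := hYρ.traceNormLE.add (hY.traceNormLE_sub_coordProj hYtr (T ×ˢ T'))
    rw [sub_add_sub_cancel] at h1
    refine h1.mono (add_le_add hη ?_)
    exact mul_le_mul_of_nonneg_left (Real.sqrt_le_sqrt htail) zero_le_two
  set c := X.trace.re with hc
  have hXtr : X.trace = (c : ℂ) := by
    have := (Complex.le_def.mp hXpsd.trace_nonneg).2
    exact Complex.ext rfl (by simpa using this.symm)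
  have hcb : |1 - c| ≤ b := by
    have h1 := hcut 1
    rw [OneMemClass.coe_one, Matrix.one_mul, trace_sub, ρ.trace_eq_one, hXtr,
      ← Complex.ofReal_one, ← Complex.ofReal_sub, Complex.norm_real] at h1
    exact h1
  have hc0 : 0 < c := by
    have := (abs_le.mp hcb).2
    linarith
  have hTne : T.Nonempty := by
    by_contra hne
    rw [Finset.not_nonempty_iff_eq_empty] at hne
    have : X.trace = 0 := Finset.sum_eq_zero fun i _ => hXrow i (by simp [hne]) i
    rw [this] at hXtr
    exact hc0.ne (by exact_mod_cast hXtr)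
  have hTc : (T.card : ℂ) ≠ 0 := by exact_mod_cast hTne.card_pos.ne'
  let W : Equiv.Perm {x // x ∈ T} × (α → ℤˣ) → unitaryGroup (α × β) ℂ :=
    fun g => extendUnitary β (signedPermOn T g)
  have htw : twirl W X = ((T.card : ℂ)⁻¹ • coordProj T) ⊗ₖ ptraceLeft X :=
    twirl_signedPermOn hTne fun i hi => hXrow i fun hi' => hi (Finset.mem_product.mp hi').1
  have hptr : (ptraceLeft X).trace = (c : ℂ) := by
    rw [← hXtr]
    simp only [Matrix.trace, Matrix.diag, ptraceLeft, Matrix.of_apply, Fintype.sum_prod_type]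
    exact Finset.sum_comm
  let τ : QState α :=
    { mat := (T.card : ℂ)⁻¹ • coordProj T
      posSemidef := by
        refine PosSemidef.smul (PosSemidef.diagonal fun i => ?_)
          (inv_nonneg.mpr (Nat.cast_nonneg _))
        by_cases hi : i ∈ T <;> simp [hi]
      trace_eq_one := by
        rw [trace_smul, coordProj, trace_diagonal]
        simp [hTc] }
  have hcc : (c : ℂ) ≠ 0 := by exact_mod_cast hc0.ne'
  let σ : QState β :=
    { mat := ((c⁻¹ : ℝ) : ℂ) • ptraceLeft X
      posSemidef := posSemidef_ofReal_smul (ptraceLeft_posSemidef hXpsd) (by positivity)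
      trace_eq_one := by
        rw [trace_smul, hptr, smul_eq_mul, ← Complex.ofReal_mul, inv_mul_cancel₀ hc0.ne',
          Complex.ofReal_one] }
  have hprod : (τ.prod σ).mat = ((c⁻¹ : ℝ) : ℂ) • twirl W X := by
    rw [htw, ← kronecker_smul]
    rfl
  obtain ⟨k, hk⟩ := exists_unitaryAverage_near_twirl W X hN
  refine ⟨fun i => signedPermOn T (k i), τ, σ, ?_⟩
  have hrow : ∀ i ∉ T ×ˢ T', ∀ j,
      (unitaryAverage (fun l => W (k l)) X - twirl W X) i j = 0 := fun i hi j => by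
    have hz : ∀ g, ((W g : Matrix (α × β) (α × β) ℂ) * X *
        (W g : Matrix (α × β) (α × β) ℂ)ᴴ) i j = 0 := fun g =>
      conj_signedPermOn_apply_eq_zero hXrow g hi j
    simp only [unitaryAverage, twirl, Matrix.sub_apply, Matrix.smul_apply, Matrix.sum_apply, hz,
      Finset.sum_const_zero, smul_zero, sub_zero]
  have hN' : (0 : ℝ) < N := by exact_mod_cast hN
  -- The three errors are the discarded part of `ρ`, the sampling error, and the normalisation of
  -- the restricted state, whose trace is `c` instead of `1`.
  have h1 := hcut.unitaryAverage hN fun l => W (k l)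
  have h2 := traceNormLE_of_rows hrow
  have h3 := ((hXpsd.twirl W).traceNormLE).smul (1 - ((c⁻¹ : ℝ) : ℂ))
  rw [trace_twirl, ← hc] at h3
  have h4 := (h1.add h2).add h3
  have hsum : unitaryAverage (fun l => W (k l)) (ρ.mat - X) +
      (unitaryAverage (fun l => W (k l)) X - twirl W X) +
      (1 - ((c⁻¹ : ℝ) : ℂ)) • twirl W X =
      randomUnitary (fun i => signedPermOn T (k i)) ρ.mat - (τ.prod σ).mat := by
    rw [hprod, unitaryAverage_sub, sub_smul, one_smul, ← unitaryAverage_extendUnitary]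
    abel
  rw [hsum] at h4
  refine h4.mono ?_
  have h5 : ‖(1 : ℂ) - ((c⁻¹ : ℝ) : ℂ)‖ * c ≤ b := by
    rw [← Complex.ofReal_one, ← Complex.ofReal_sub, Complex.norm_real, Real.norm_eq_abs]
    rw [← abs_of_pos hc0, ← abs_mul, abs_of_pos hc0, sub_mul, inv_mul_cancel₀ hc0.ne', one_mul,
      abs_sub_comm]
    exact hcb
  have h6 : √((T ×ˢ T').card * hsNormSq (unitaryAverage (fun l => W (k l)) X - twirl W X)) ≤
      √(T.card * T'.card * (h / N)) := by
    refine Real.sqrt_le_sqrt ?_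
    rw [Finset.card_product, Nat.cast_mul]
    refine mul_le_mul_of_nonneg_left (hk.trans ?_)
      (mul_nonneg (Nat.cast_nonneg _) (Nat.cast_nonneg _))
    refine div_le_div_of_nonneg_right ?_ hN'.le
    exact (hsNormSq_coordProj_conj_le _ _).trans hYh
  linarith

end OneShot

/-! ### Diagonal frames for the marginals -/

section Frames

variable {α β : Type*} [Fintype α] [DecidableEq α] [Fintype β] [DecidableEq β]

/-- The unitary `1 ⊗ W`. -/
def extendUnitaryRight (α : Type*) [Fintype α] [DecidableEq α] (W : unitaryGroup β ℂ) :
    unitaryGroup (α × β) ℂ :=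
  ⟨(1 : Matrix α α ℂ) ⊗ₖ (W : Matrix β β ℂ), kronecker_mem_unitary (one_mem _) W.2⟩

theorem conj_extendRight_submatrix_swap {α β : Type*} [Fintype α] [DecidableEq α] [Fintype β]
    (W : Matrix β β ℂ) (M : Matrix (α × β) (α × β) ℂ) :
    (((1 : Matrix α α ℂ) ⊗ₖ W) * M * ((1 : Matrix α α ℂ) ⊗ₖ W)ᴴ).submatrix
        (Equiv.prodComm β α) (Equiv.prodComm β α) =
      (W ⊗ₖ (1 : Matrix α α ℂ)) * M.submatrix (Equiv.prodComm β α) (Equiv.prodComm β α) *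
        (W ⊗ₖ (1 : Matrix α α ℂ))ᴴ := by
  have h : W ⊗ₖ (1 : Matrix α α ℂ) = ((1 : Matrix α α ℂ) ⊗ₖ W).submatrix
      (Equiv.prodComm β α) (Equiv.prodComm β α) := by
    ext ⟨i, i'⟩ ⟨j, j'⟩
    simp [kroneckerMap_apply, mul_comm]
  rw [h, conjTranspose_submatrix, submatrix_mul_equiv, submatrix_mul_equiv]

theorem ptraceLeft_conj_extendRight (W : unitaryGroup β ℂ) (M : Matrix (α × β) (α × β) ℂ) :
    ptraceLeft (((1 : Matrix α α ℂ) ⊗ₖ (W : Matrix β β ℂ)) * M *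
      ((1 : Matrix α α ℂ) ⊗ₖ (W : Matrix β β ℂ))ᴴ) =
      (W : Matrix β β ℂ) * ptraceLeft M * (W : Matrix β β ℂ)ᴴ :=
  (congrArg ptraceRight (conj_extendRight_submatrix_swap (W : Matrix β β ℂ) M)).trans
    (ptraceRight_conj_extend W _)

theorem ptraceRight_conj_extendRight (W : unitaryGroup β ℂ) (M : Matrix (α × β) (α × β) ℂ) :
    ptraceRight (((1 : Matrix α α ℂ) ⊗ₖ (W : Matrix β β ℂ)) * M *
      ((1 : Matrix α α ℂ) ⊗ₖ (W : Matrix β β ℂ))ᴴ) = ptraceRight M :=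
  (congrArg ptraceLeft (conj_extendRight_submatrix_swap (W : Matrix β β ℂ) M)).trans
    (ptraceLeft_conj_extend W _)

namespace QState

/-- The unitary conjugate `U ρ Uᴴ` of a state. -/
def conj {ι : Type*} [Fintype ι] [DecidableEq ι] (U : unitaryGroup ι ℂ) (ρ : QState ι) :
    QState ι where
  mat := (U : Matrix ι ι ℂ) * ρ.mat * (U : Matrix ι ι ℂ)ᴴ
  posSemidef := ρ.posSemidef.mul_mul_conjTranspose_same _
  trace_eq_one := by rw [trace_unitary_conj, ρ.trace_eq_one]

theorem conj_extend_fst (U : unitaryGroup α ℂ) (ρ : QState (α × β)) :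
    (ρ.conj (extendUnitary β U)).fst = ρ.fst.conj U :=
  ext_mat (ptraceRight_conj_extend U ρ.mat)

theorem conj_extend_snd (U : unitaryGroup α ℂ) (ρ : QState (α × β)) :
    (ρ.conj (extendUnitary β U)).snd = ρ.snd :=
  ext_mat (ptraceLeft_conj_extend U ρ.mat)

theorem conj_extendRight_fst (W : unitaryGroup β ℂ) (ρ : QState (α × β)) :
    (ρ.conj (extendUnitaryRight α W)).fst = ρ.fst :=
  ext_mat (ptraceRight_conj_extendRight W ρ.mat)

theorem conj_extendRight_snd (W : unitaryGroup β ℂ) (ρ : QState (α × β)) :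
    (ρ.conj (extendUnitaryRight α W)).snd = ρ.snd.conj W :=
  ext_mat (ptraceLeft_conj_extendRight W ρ.mat)

theorem conj_star_mat_of_eq {ι : Type*} [Fintype ι] [DecidableEq ι] {U : unitaryGroup ι ℂ}
    {ρ : QState ι} {D : Matrix ι ι ℂ}
    (h : ρ.mat = (U : Matrix ι ι ℂ) * D * (U : Matrix ι ι ℂ)ᴴ) : (ρ.conj (star U)).mat = D := by
  change ((star U : unitaryGroup ι ℂ) : Matrix ι ι ℂ) * ρ.mat *
    ((star U : unitaryGroup ι ℂ) : Matrix ι ι ℂ)ᴴ = D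
  rw [Unitary.coe_star, star_eq_conjTranspose, conjTranspose_conjTranspose, h]
  simp only [Matrix.mul_assoc, unitary_conjTranspose_mul_self, Matrix.mul_one]
  rw [← Matrix.mul_assoc, unitary_conjTranspose_mul_self, Matrix.one_mul]

/-- The state `(U ⊗ W)ᴴ ρ (U ⊗ W)`. -/
def localFrame (U : unitaryGroup α ℂ) (W : unitaryGroup β ℂ) (ρ : QState (α × β)) :
    QState (α × β) :=
  (ρ.conj (extendUnitaryRight α (star W))).conj (extendUnitary β (star U))

theorem localFrame_fst (U : unitaryGroup α ℂ) (W : unitaryGroup β ℂ) (ρ : QState (α × β)) :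
    (ρ.localFrame U W).fst = ρ.fst.conj (star U) := by
  rw [localFrame, conj_extend_fst, conj_extendRight_fst]

theorem localFrame_snd (U : unitaryGroup α ℂ) (W : unitaryGroup β ℂ) (ρ : QState (α × β)) :
    (ρ.localFrame U W).snd = ρ.snd.conj (star W) := by
  rw [localFrame, conj_extend_snd, conj_extendRight_snd]

theorem entropy_conj {ι : Type*} [Fintype ι] [DecidableEq ι] (U : unitaryGroup ι ℂ)
    (ρ : QState ι) : (ρ.conj U).entropy = ρ.entropy := by
  rw [entropy_eq, entropy_eq, conj, trNegMulLog_unitary_conj]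

/-- Subadditivity of the Shannon entropy, by Gibbs' inequality. The case `f (a, b) = 0` is separate,
because a marginal may vanish there. -/
theorem _root_.sum_negMulLog_le_add {α β : Type*} [Fintype α] [Fintype β]
    {f : α × β → ℝ} (hf : ∀ x, 0 ≤ f x) (hf1 : ∑ x, f x = 1) :
    ∑ x, negMulLog (f x) ≤
      ∑ a, negMulLog (∑ b, f (a, b)) + ∑ b, negMulLog (∑ a, f (a, b)) := by
  have key : ∀ a b, negMulLog (f (a, b)) ≤ -(f (a, b) * log (∑ b, f (a, b))) -
      f (a, b) * log (∑ a, f (a, b)) + (∑ b, f (a, b)) * (∑ a, f (a, b)) - f (a, b) := by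
    intro a b
    have hp : f (a, b) ≤ ∑ b, f (a, b) :=
      Finset.single_le_sum (f := fun b => f (a, b)) (fun b _ => hf (a, b)) (Finset.mem_univ b)
    have hr : f (a, b) ≤ ∑ a, f (a, b) :=
      Finset.single_le_sum (f := fun a => f (a, b)) (fun a _ => hf (a, b)) (Finset.mem_univ a)
    rcases (hf (a, b)).eq_or_lt with h0 | h0
    · rw [← h0] at hp hr ⊢
      simp only [negMulLog_zero, zero_mul, neg_zero, sub_zero, zero_add]
      exact mul_nonneg hp hr
    · set p := ∑ b, f (a, b)
      set r := ∑ a, f (a, b)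
      have hp0 : 0 < p := h0.trans_le hp
      have hr0 : 0 < r := h0.trans_le hr
      have h1 := log_le_sub_one_of_pos (x := p * r / f (a, b)) (by positivity)
      rw [log_div (by positivity) h0.ne', log_mul hp0.ne' hr0.ne'] at h1
      have h2 := mul_le_mul_of_nonneg_left h1 h0.le
      have h3 : f (a, b) * (p * r / f (a, b) - 1) = p * r - f (a, b) := by
        field_simp
      rw [negMulLog]
      linarith
  rw [Fintype.sum_prod_type] at hf1 ⊢
  refine (Finset.sum_le_sum fun a _ => Finset.sum_le_sum fun b _ => key a b).trans_eq ?_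
  have h1 : ∑ a, ∑ b, f (a, b) * log (∑ a, f (a, b)) =
      -∑ b, negMulLog (∑ a, f (a, b)) := by
    rw [Finset.sum_comm, ← Finset.sum_neg_distrib]
    refine Finset.sum_congr rfl fun b _ => ?_
    rw [← Finset.sum_mul, negMulLog]
    ring
  have h2 : ∑ a, ∑ b, f (a, b) * log (∑ b, f (a, b)) =
      -∑ a, negMulLog (∑ b, f (a, b)) := by
    rw [← Finset.sum_neg_distrib]
    refine Finset.sum_congr rfl fun a _ => ?_
    rw [← Finset.sum_mul, negMulLog]
    ring
  have h3 : ∑ a, ∑ b, (∑ b, f (a, b)) * (∑ a, f (a, b)) = 1 := by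
    simp only [← Finset.mul_sum]
    rw [← Finset.sum_mul, hf1, one_mul, Finset.sum_comm, hf1]
  simp only [Finset.sum_sub_distrib, Finset.sum_add_distrib, Finset.sum_neg_distrib, h1, h2, h3,
    hf1]
  ring

/-- In the local frame of the eigenbases of the marginals, Peierls' inequality reduces the claim to
classical subadditivity. -/
theorem mutualInfo_nonneg (ρ : QState (α × β)) : 0 ≤ ρ.mutualInfo := by
  obtain ⟨U, p, -, -, hU, hSA⟩ := ρ.fst.exists_spectral
  obtain ⟨W, r, -, -, hW, hSB⟩ := ρ.snd.exists_spectral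
  set f : α × β → ℝ := fun x => ((ρ.localFrame U W).mat x x).re with hf
  have hf0 : ∀ x, 0 ≤ f x := fun x =>
    (Complex.le_def.mp (ρ.localFrame U W).posSemidef.diag_nonneg).1
  have hf1 : ∑ x, f x = 1 := by
    have := congrArg Complex.re (ρ.localFrame U W).trace_eq_one
    simpa [Matrix.trace] using this
  have hp : ∀ a, ∑ b, f (a, b) = p a := fun a => by
    have h := congrFun (congrFun (congrArg QState.mat (ρ.localFrame_fst U W)) a) a
    rw [conj_star_mat_of_eq hU, diagonal_apply_eq] at h
    have := congrArg Complex.re h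
    simpa [fst, ptraceRight] using this
  have hr : ∀ b, ∑ a, f (a, b) = r b := fun b => by
    have h := congrFun (congrFun (congrArg QState.mat (ρ.localFrame_snd U W)) b) b
    rw [conj_star_mat_of_eq hW, diagonal_apply_eq] at h
    have := congrArg Complex.re h
    simpa [snd, ptraceLeft] using this
  have h1 := (ρ.localFrame U W).posSemidef.trNegMulLog_le_diag
  have h2 := sum_negMulLog_le_add hf0 hf1
  simp only [hp, hr] at h2
  have h3 : (ρ.localFrame U W).entropy = ρ.entropy := by
    rw [localFrame, entropy_conj, entropy_conj]
  rw [entropy_eq, div_eq_iff (log_pos one_lt_two).ne'] at h3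
  have h4 : 0 ≤ ρ.mutualInfo * log 2 := by
    rw [mutualInfo, sub_mul, add_mul, hSA, hSB, ← h3]
    linarith
  exact nonneg_of_mul_nonneg_left h4 (log_pos one_lt_two)

end QState

end Frames

/-! ### Decoupling at any rate above the mutual information -/

section Direct

variable {α β γ : Type*} [Fintype α] [DecidableEq α] [Fintype β] [DecidableEq β]
  [Fintype γ] [DecidableEq γ]

/-- With `V * star U` on the first factor, the action on `M` is that of `V` on the matrix rotated to
the local frame of `U` and `W`, followed by a rotation back on the second factor alone. -/
theorem conj_extend_mul_star (V U : unitaryGroup α ℂ) (W : unitaryGroup β ℂ)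
    (M : Matrix (α × β) (α × β) ℂ) :
    (extendUnitary β (V * star U) : Matrix (α × β) (α × β) ℂ) * M *
        (extendUnitary β (V * star U) : Matrix (α × β) (α × β) ℂ)ᴴ =
      (extendUnitaryRight α W : Matrix (α × β) (α × β) ℂ) *
        ((extendUnitary β V : Matrix (α × β) (α × β) ℂ) *
          ((extendUnitary β (star U) : Matrix (α × β) (α × β) ℂ) *
            ((extendUnitaryRight α (star W) : Matrix (α × β) (α × β) ℂ) * M *
              (extendUnitaryRight α (star W) : Matrix (α × β) (α × β) ℂ)ᴴ) *
            (extendUnitary β (star U) : Matrix (α × β) (α × β) ℂ)ᴴ) *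
          (extendUnitary β V : Matrix (α × β) (α × β) ℂ)ᴴ) *
        (extendUnitaryRight α W : Matrix (α × β) (α × β) ℂ)ᴴ := by
  have h : (extendUnitary β (V * star U) : Matrix (α × β) (α × β) ℂ) =
      (extendUnitaryRight α W : Matrix (α × β) (α × β) ℂ) *
        (extendUnitary β V : Matrix (α × β) (α × β) ℂ) *
        (extendUnitary β (star U) : Matrix (α × β) (α × β) ℂ) *
        (extendUnitaryRight α (star W) : Matrix (α × β) (α × β) ℂ) := by
    simp only [extendUnitary, extendUnitaryRight, ← mul_kronecker_mul, Submonoid.coe_mul,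
      Matrix.one_mul, Matrix.mul_one]
    rw [Unitary.coe_star (U := W), star_eq_conjTranspose, unitary_mul_conjTranspose_self]
  rw [h]
  simp only [conjTranspose_mul, Matrix.mul_assoc]

theorem unitaryAverage_unitary_conj {ι : Type*} [Fintype ι] [DecidableEq ι] {N : ℕ}
    (W : Matrix ι ι ℂ) (U : Fin N → unitaryGroup ι ℂ) (M : Matrix ι ι ℂ) :
    (N : ℂ)⁻¹ • ∑ k, W * ((U k : Matrix ι ι ℂ) * M * (U k : Matrix ι ι ℂ)ᴴ) * Wᴴ =
      W * unitaryAverage U M * Wᴴ := by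
  rw [unitaryAverage, Matrix.mul_smul, Matrix.smul_mul, Matrix.mul_sum, Matrix.sum_mul]

/-- One-shot decoupling in terms of the spectra of the state and of its marginals: `T`, `T'` index
the likely eigenvectors of the marginals and `S` the eigenvectors of the state of eigenvalue at
most `h`. -/
theorem exists_decoupling (ρ : QState (α × β)) {U : unitaryGroup α ℂ} {p : α → ℝ}
    (hU : ρ.fst.mat = (U : Matrix α α ℂ) * diagonal (fun i => (p i : ℂ)) * (U : Matrix α α ℂ)ᴴ)
    {W : unitaryGroup β ℂ} {r : β → ℝ}
    (hW : ρ.snd.mat = (W : Matrix β β ℂ) * diagonal (fun i => (r i : ℂ)) * (W : Matrix β β ℂ)ᴴ)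
    {K : unitaryGroup (α × β) ℂ} {q : α × β → ℝ} (hq : ∀ x, 0 ≤ q x) (hq1 : ∑ x, q x = 1)
    (hK : ρ.mat = (K : Matrix (α × β) (α × β) ℂ) * diagonal (fun i => (q i : ℂ)) *
      (K : Matrix (α × β) (α × β) ℂ)ᴴ)
    {T : Finset α} {T' : Finset β} {S : Finset (α × β)} {η h : ℝ}
    (hT : ∑ a ∈ Tᶜ, p a ≤ η) (hT' : ∑ b ∈ T'ᶜ, r b ≤ η) (hS : ∑ x ∈ Sᶜ, q x ≤ η)
    (hSh : ∀ x ∈ S, q x ≤ h) (hh : 0 ≤ h) {N : ℕ} (hN : 0 < N) (hη1 : η + 2 * √(2 * η) < 1) :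
    ∃ (V : Fin N → unitaryGroup α ℂ) (τ : QState α) (σ : QState β),
      TraceNormLE (randomUnitary V ρ.mat - (τ.prod σ).mat)
        (2 * (η + 2 * √(2 * η)) + √(T.card * T'.card * (h / N))) := by
  -- `Y` keeps the small eigenvalues of `ρ`; both `Y` and `ρ - Y` are conjugated to the local frame.
  let D : (α × β → ℝ) → Matrix (α × β) (α × β) ℂ := fun f =>
    (K : Matrix (α × β) (α × β) ℂ) * diagonal (fun i => (f i : ℂ)) *
      (K : Matrix (α × β) (α × β) ℂ)ᴴ
  let L : Matrix (α × β) (α × β) ℂ → Matrix (α × β) (α × β) ℂ := fun M =>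
    (extendUnitary β (star U) : Matrix (α × β) (α × β) ℂ) *
      ((extendUnitaryRight α (star W) : Matrix (α × β) (α × β) ℂ) * M *
        (extendUnitaryRight α (star W) : Matrix (α × β) (α × β) ℂ)ᴴ) *
      (extendUnitary β (star U) : Matrix (α × β) (α × β) ℂ)ᴴ
  have hD : ∀ f : α × β → ℝ, (∀ x, 0 ≤ f x) → (D f).PosSemidef := fun f hf =>
    (PosSemidef.diagonal fun i => Complex.zero_le_real.mpr (hf i)).mul_mul_conjTranspose_same _
  have hL : ∀ {M}, M.PosSemidef → (L M).PosSemidef := fun hM =>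
    (hM.mul_mul_conjTranspose_same _).mul_mul_conjTranspose_same _
  have hLsub : ∀ M M', L (M - M') = L M - L M' := fun M M' => by
    simp only [L, Matrix.mul_sub, Matrix.sub_mul]
  have hLtr : ∀ M, (L M).trace = M.trace := fun M => by
    simp only [L, trace_unitary_conj]
  have hLhs : ∀ M, hsNormSq (L M) = hsNormSq M := fun M => by
    simp only [L, hsNormSq_unitary_conj]
  have hLρ : (ρ.localFrame U W).mat = L ρ.mat := rfl
  let q₁ : α × β → ℝ := fun x => if x ∈ S then q x else 0
  let q₂ : α × β → ℝ := fun x => if x ∈ S then 0 else q x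
  have hq₁ : ∀ x, 0 ≤ q₁ x := fun x => by
    simp only [q₁]
    split_ifs
    exacts [hq x, le_rfl]
  have hq₂ : ∀ x, 0 ≤ q₂ x := fun x => by
    simp only [q₂]
    split_ifs
    exacts [le_rfl, hq x]
  have hsub : ρ.mat - D q₁ = D q₂ := by
    rw [hK]
    simp only [D]
    rw [← Matrix.sub_mul, ← Matrix.mul_sub, diagonal_sub]
    congr! with x
    by_cases hx : x ∈ S <;> simp [q₁, q₂, hx]
  have htr : (D q₂).trace.re ≤ η := by
    simp only [D]
    rw [trace_unitary_conj, trace_diagonal, Complex.re_sum]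
    refine le_trans (le_of_eq ?_) hS
    simp only [Complex.ofReal_re, q₂]
    rw [← Finset.sum_subset (Finset.subset_univ Sᶜ)]
    · exact Finset.sum_congr rfl fun x hx => if_neg (Finset.mem_compl.mp hx)
    · intro x _ hx
      simp only [Finset.mem_compl, not_not] at hx
      simp [hx]
  have hhs : hsNormSq (D q₁) ≤ h := by
    simp only [D]
    rw [hsNormSq_unitary_conj]
    have h1 : ∀ i j, ‖diagonal (fun i => (q₁ i : ℂ)) i j‖ ^ 2 =
        if i = j then q₁ i ^ 2 else 0 := fun i j => by
      by_cases hij : i = j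
      · subst hij
        simp
      · simp [hij]
    simp only [hsNormSq, h1, Finset.sum_ite_eq, Finset.mem_univ, if_true]
    calc ∑ x, q₁ x ^ 2 ≤ ∑ x, h * q x := by
          refine Finset.sum_le_sum fun x _ => ?_
          by_cases hx : x ∈ S
          · simp only [q₁, hx, if_true, sq]
            exact mul_le_mul_of_nonneg_right (hSh x hx) (hq x)
          · simp only [q₁, hx, if_false]
            have := mul_nonneg hh (hq x)
            simpa using this
      _ = h := by rw [← Finset.mul_sum, hq1, mul_one]
  obtain ⟨V, τ, σ, hV⟩ := exists_decoupling_coordProj (ρ.localFrame U W) T T' (Y := L (D q₁))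
    (η := η) (h := h) (hL (hD q₁ hq₁))
    (by rw [hLρ, ← hLsub, hsub]; exact hL (hD q₂ hq₂))
    (by rw [hLρ, ← hLsub, hsub, hLtr]; exact htr)
    (by
      rw [QState.localFrame_fst, QState.conj_star_mat_of_eq hU]
      simpa using hT)
    (by
      rw [QState.localFrame_snd, QState.conj_star_mat_of_eq hW]
      simpa using hT')
    (by rw [hLhs]; exact hhs) hN hη1
  refine ⟨fun k => V k * star U, τ, σ.conj W, ?_⟩
  have h1 : randomUnitary (fun k => V k * star U) ρ.mat =
      (extendUnitaryRight α W : Matrix (α × β) (α × β) ℂ) *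
        randomUnitary V (ρ.localFrame U W).mat *
        (extendUnitaryRight α W : Matrix (α × β) (α × β) ℂ)ᴴ := by
    rw [← unitaryAverage_extendUnitary, ← unitaryAverage_extendUnitary,
      ← unitaryAverage_unitary_conj, unitaryAverage]
    congr 1
    exact Finset.sum_congr rfl fun k _ => conj_extend_mul_star (V k) U W ρ.mat
  have h2 : (τ.prod (σ.conj W)).mat = (extendUnitaryRight α W : Matrix (α × β) (α × β) ℂ) *
        (τ.prod σ).mat * (extendUnitaryRight α W : Matrix (α × β) (α × β) ℂ)ᴴ := by
    simp only [QState.prod, QState.conj, extendUnitaryRight, conjTranspose_kronecker,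
      ← mul_kronecker_mul, conjTranspose_one, Matrix.one_mul, Matrix.mul_one]
  rw [h1, h2, ← Matrix.sub_mul, ← Matrix.mul_sub]
  exact hV.unitary_conj _

/-- A quantitative form of asymptotic equipartition for states. -/
theorem QState.exists_typical {ι : Type*} [Fintype ι] [DecidableEq ι] (ρ : QState ι) {δ : ℝ}
    (hδ : 0 < δ) : ∃ v : ℝ, 0 ≤ v ∧ ∀ {κ : Type*} [Fintype κ] [DecidableEq κ] (σ : QState κ)
      (n : ℕ), 0 < n → σ.IsPow ρ n →
      ∃ (U : unitaryGroup κ ℂ) (d : κ → ℝ), (∀ x, 0 ≤ d x) ∧ ∑ x, d x = 1 ∧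
        σ.mat = (U : Matrix κ κ ℂ) * diagonal (fun i => (d i : ℂ)) * (U : Matrix κ κ ℂ)ᴴ ∧
        (∃ T : Finset κ, (T.card : ℝ) ≤ exp (n * (ρ.entropy * log 2 + δ)) ∧
          ∑ x ∈ Tᶜ, d x ≤ v / n) ∧
        ∃ S : Finset κ, (∀ x ∈ S, d x ≤ exp (-(n * (ρ.entropy * log 2 - δ)))) ∧
          ∑ x ∈ Sᶜ, d x ≤ v / n := by
  obtain ⟨U, p, hp0, hp, hU, hS⟩ := ρ.exists_spectral
  refine ⟨surprisalVariance p / δ ^ 2,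
    div_nonneg (surprisalVariance_nonneg hp0) (sq_nonneg _), ?_⟩
  intro κ _ _ σ n hn hσ
  obtain ⟨e, he⟩ := hσ
  obtain ⟨W, hW⟩ := QState.IsPow.exists_spectral he hU
  have hsum : ∀ s : Finset (Fin n → ι), ∑ x ∈ (s.map e.symm.toEmbedding)ᶜ, ∏ i, p (e x i) =
      ∑ x ∈ sᶜ, ∏ i, p (x i) := fun s => by
    refine Finset.sum_equiv e (fun x => ?_) fun x _ => rfl
    simp [Finset.mem_map_equiv]
  obtain ⟨T, hTc, hT⟩ := exists_likely_set hp0 hp hn hδ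
  obtain ⟨S, hSc, hS'⟩ := exists_spread_set hp0 hp hn hδ
  rw [hS]
  refine ⟨W, _, fun x => Finset.prod_nonneg fun i _ => hp0 _, ?_, hW,
    ⟨T.map e.symm.toEmbedding, by rwa [Finset.card_map], by rwa [hsum]⟩,
    ⟨S.map e.symm.toEmbedding, fun x hx => hSc (e x) ?_, by rwa [hsum]⟩⟩
  · rw [← sum_prod_eq_one hp n]
    exact Fintype.sum_equiv e _ _ fun x => rfl
  · simpa [Finset.mem_map_equiv] using hx

theorem tendsto_decoupling_error {v δ : ℝ} (hδ : 0 < δ) :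
    Filter.Tendsto (fun n : ℕ => 2 * (v / n + 2 * √(2 * (v / n))) + √(2 * exp (-(n * δ))))
      Filter.atTop (nhds 0) := by
  have h1 : Filter.Tendsto (fun n : ℕ => v / (n : ℝ)) Filter.atTop (nhds 0) :=
    tendsto_const_div_atTop_nhds_zero_nat v
  have h2 : Filter.Tendsto (fun n : ℕ => exp (-((n : ℝ) * δ))) Filter.atTop (nhds 0) :=
    tendsto_exp_neg_atTop_nhds_zero.comp (tendsto_natCast_atTop_atTop.atTop_mul_const hδ)
  have h3 : Filter.Tendsto (fun n : ℕ => √(2 * (v / (n : ℝ)))) Filter.atTop (nhds 0) := by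
    have := (Real.continuous_sqrt.tendsto _).comp (h1.const_mul 2)
    rwa [mul_zero, Real.sqrt_zero] at this
  have h4 : Filter.Tendsto (fun n : ℕ => √(2 * exp (-((n : ℝ) * δ)))) Filter.atTop (nhds 0) := by
    have := (Real.continuous_sqrt.tendsto _).comp (h2.const_mul 2)
    rwa [mul_zero, Real.sqrt_zero] at this
  simpa using ((h1.add (h3.const_mul 2)).const_mul 2).add h4

theorem half_le_floor {x : ℝ} (hx : 1 ≤ x) : x / 2 ≤ (⌊x⌋₊ : ℝ) := by
  have h1 : (1 : ℝ) ≤ ⌊x⌋₊ := by exact_mod_cast Nat.floor_pos.mpr hx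
  have h2 := Nat.lt_floor_add_one x
  linarith

namespace QState

theorem isDecoupledWith_of_mutualInfo_lt (ρ : QState (α × β × γ)) {R : ℝ}
    (hR : mutualInfo (α := α) (β := β × γ) ρ < R) : ρ.IsDecoupledWith R := by
  have hl := log_pos one_lt_two
  have hI := mutualInfo_nonneg (α := α) (β := β × γ) ρ
  -- One quarter of the gap is lost in each of the three typical sets, and one is kept.
  set δ := (R - mutualInfo (α := α) (β := β × γ) ρ) * log 2 / 4 with hδ_def
  have hδ : 0 < δ := by have := sub_pos.mpr hR; positivity
  obtain ⟨v₁, hv₁, hA⟩ := exists_typical (fst (α := α) (β := β × γ) ρ) hδ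
  obtain ⟨v₂, hv₂, hE⟩ := exists_typical ρ.snd hδ
  obtain ⟨v₃, hv₃, hAE⟩ := exists_typical ρ hδ
  set v := v₁ + v₂ + v₃ with hv
  intro ε hε
  have hlim := tendsto_decoupling_error (v := v) hδ
  obtain ⟨n₀, hn₀⟩ := Filter.eventually_atTop.mp
    (hlim.eventually (gt_mem_nhds (lt_min hε zero_lt_one)))
  refine ⟨max n₀ 1, fun n hn => ?_⟩
  have hn1 : 0 < n := (le_max_right n₀ 1).trans hn
  have hnpos : (0 : ℝ) < n := by exact_mod_cast hn1
  have hsmall := hn₀ n ((le_max_left n₀ 1).trans hn)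
  have hpow : (1 : ℝ) ≤ 2 ^ ((n : ℝ) * R) :=
    Real.one_le_rpow one_le_two (mul_nonneg hnpos.le (hI.trans hR.le))
  have hN : 0 < ⌊(2 : ℝ) ^ ((n : ℝ) * R)⌋₊ := Nat.floor_pos.mpr hpow
  refine ⟨hN, ?_⟩
  have hNhalf := half_le_floor hpow
  generalize ⌊(2 : ℝ) ^ ((n : ℝ) * R)⌋₊ = N at hN hNhalf ⊢
  have hN' : (0 : ℝ) < N := by exact_mod_cast hN
  obtain ⟨U, p, -, -, hU, ⟨T, hTc, hT⟩, -⟩ := hA _ n hn1 (ρ.copies_fst_isPow n)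
  obtain ⟨W, r, -, -, hW, ⟨T', hTc', hT'⟩, -⟩ := hE _ n hn1 (ρ.copies_snd_isPow n)
  obtain ⟨K, q, hq, hq1, hK, -, ⟨S, hSc, hS⟩⟩ := hAE _ n hn1 (ρ.copies_isPow n)
  have hmono : ∀ {w : ℝ}, w ≤ v → w / n ≤ v / n := fun hw =>
    div_le_div_of_nonneg_right hw hnpos.le
  have hb0 : 0 ≤ v / n := by positivity
  have hη1 : v / n + 2 * √(2 * (v / n)) < 1 := by
    have h1 := hsmall.trans_le (min_le_right _ _)
    have h2 := Real.sqrt_nonneg (2 * exp (-(n * δ)))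
    have h3 := Real.sqrt_nonneg (2 * (v / n))
    linarith
  obtain ⟨V, τ, σ, hV⟩ := exists_decoupling (α := Fin n → α) (β := (Fin n → β) × (Fin n → γ))
    (ρ.copies n) hU hW hq hq1 hK
    (hT.trans (hmono (by linarith))) (hT'.trans (hmono (by linarith)))
    (hS.trans (hmono (by linarith))) hSc (exp_pos _).le hN hη1
  refine ⟨V, τ, σ, ?_⟩
  have hherm : (randomUnitary V (ρ.tensorPower n) - (τ.prod σ).mat).IsHermitian := by
    rw [← unitaryAverage_extendUnitary]
    exact ((ρ.copies n).posSemidef.isHermitian.unitaryAverage _).sub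
      (τ.prod σ).posSemidef.isHermitian
  refine hherm.traceNorm_le (hV.mono ?_)
  refine le_trans ?_ (hsmall.le.trans (min_le_left _ _))
  refine add_le_add le_rfl (Real.sqrt_le_sqrt ?_)
  have hNexp : exp (n * (R * log 2)) / 2 ≤ N := by
    rwa [rpow_def_of_pos two_pos, mul_comm (log 2), mul_assoc] at hNhalf
  have hexp : exp (n * ((fst (α := α) (β := β × γ) ρ).entropy * log 2 + δ)) *
      exp (n * (ρ.snd.entropy * log 2 + δ)) * exp (-(n * (ρ.entropy * log 2 - δ))) =
      exp (n * (R * log 2)) * exp (-(n * δ)) := by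
    rw [← Real.exp_add, ← Real.exp_add, ← Real.exp_add]
    congr 1
    have : 4 * δ = (R - mutualInfo (α := α) (β := β × γ) ρ) * log 2 := by
      rw [hδ_def]
      ring
    rw [mutualInfo] at this
    linear_combination (n : ℝ) * this
  rw [← mul_div_assoc, div_le_iff₀ hN']
  calc (T.card : ℝ) * T'.card * exp (-(n * (ρ.entropy * log 2 - δ)))
      ≤ exp (n * (R * log 2)) * exp (-(n * δ)) := by
        rw [← hexp]
        gcongr
    _ = 2 * exp (-(n * δ)) * (exp (n * (R * log 2)) / 2) := by ring
    _ ≤ 2 * exp (-(n * δ)) * N := by gcongr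

/-- **Strong subadditivity**: `I(A:B) ≤ I(A:BC)`. Any rate above `I(A:BC)` decouples `A` from `BC`,
hence from `B`, and this is impossible below the rate `I(A:B)`. -/
theorem condMutualInfo_nonneg (ρ : QState (α × β × γ)) : 0 ≤ ρ.condMutualInfo := by
  rw [condMutualInfo_eq_sub, sub_nonneg]
  exact le_of_forall_gt_imp_ge_of_dense fun R hR =>
    (ρ.isDecoupledWith_of_mutualInfo_lt hR).mutualInfo_le

end QState

end Direct

/-! ### Bounds on the Markovianizing cost -/

theorem mainTheorem4 {A B C : Type*} [Fintype A] [DecidableEq A] [Fintype B] [DecidableEq B]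
    [Fintype C] [DecidableEq C] (ρ : QState (A × B × C)) :
    ((ρ.condMutualInfo : ℝ) : EReal) ≤ markovCost ρ ∧
      markovCost ρ ≤ ((QState.mutualInfo (α := A) (β := B × C) ρ : ℝ) : EReal) ∧
      (markovCost ρ = 0 → ρ.IsMarkov) := by
  have hlower : ((ρ.condMutualInfo : ℝ) : EReal) ≤ markovCost ρ :=
    le_iInf₂ fun R hR => EReal.coe_le_coe_iff.mpr
      (QState.condMutualInfo_le_of_isMarkovianizedWith hR)
  refine ⟨hlower, ?_, fun h0 => ?_⟩
  · refine EReal.le_of_forall_lt_iff_le.mp fun R hR => ?_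
    exact iInf₂_le R (ρ.isDecoupledWith_of_mutualInfo_lt
      (EReal.coe_lt_coe_iff.mp hR)).isMarkovianizedWith
  · rw [h0] at hlower
    exact le_antisymm (by exact_mod_cast hlower) ρ.condMutualInfo_nonneg
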